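/- Let $\beta,\sigma,\phi_1,\phi_2\ge 0$, $\sigma_r,\sigma_c>0$, $r>0$, $\gamma\in(0,1)$. Consider the market with state $z_t=(d_t,s_t,p_t,y_t)\in\mathbb R^4$ (demand, supply, price, renewable supply), $$z_{t+1}=A_r z_t+b_r u_t+n_t,\qquad A_r=\begin{pmatrix}\beta&0&-\phi_1&0\\0&\sigma&\phi_2&1\\0&0&1&0\\0&0&\sigma_c&\sigma_r\end{pmatrix},\qquad b_r=(0,0,1,0)^T,$$ where $u_t\in\mathbb R$ is the price control and the $n_t$ are i.i.d. with mean $0$, finite second moments and covariance matrix $\mathrm{diag}(\psi_d,\psi_s,0,\psi_r)$. Let $Q=C^TC$ be such that $(A_r,b_r)$ is controllable and $(A_r,C)$ is observable. For a nonanticipatory (possibly randomized, history-dependent) policy $\pi$ and an initial state $z_0$ put $$\mathcal E(\pi)=-\mathbb E^\pi_{z_0}\sum_{t\ge0}\gamma^t z_t^TQz_t,\qquad \mathcal V(\pi)=\mathbb E^\pi_{z_0}\sum_{t\ge0}\gamma^t u_t^2,$$ and call $\pi$ admissible if both are finite, and optimal if it attains $\inf_{\pi}\mathbb E^\pi_{z_0}\sum_{t\ge0}\gamma^t(z_t^TQz_t+r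 u_t^2)$. Consider two renewable sources, i.e. two such systems ($i=1,2$) that have the same parameters $\beta,\sigma,\phi_1,\phi_2,\sigma_r,\sigma_c,Q,r,\gamma,\psi_d,\psi_s$ and the same initial state $z_0$, but disturbance laws with renewable variances $\psi_r^{(1)}<\psi_r^{(2)}$. Then optimal policies exist in both systems, and for all optimal policies $\pi^*_1,\pi^*_2$ of systems $1,2$: (a) Both are admissible, and $\mathcal V_1(\pi^*_1)\le\mathcal V_2(\pi^*_2)$. The inequality is strict, $\mathcal V_1(\pi_1^*)<\mathcal V_2(\pi_2^*)$, if and only if leaving the price alone is not an optimal response to a renewable supply shock, i.e. if and only if in the disturbance-free system $z_{t+1}=A_rz_t+b_ru_t$ started at $(0,0,0,1)^T$ some control sequence has a strictly smaller cost $\sum_t\gamma^t(z_t^TQz_t+ru_t^2)$ than $u\equiv0$. (b) At equal social welfare, the price volatility is always strictly larger for the second source: if $\mathcal V^*_i(e)\in[0,\infty]$ denotes the infimum of $\mathcal V_i(\pi)$ over the admissible policies $\pi$ of system $i$ with efficiency $\mathcal E_i(\pi)\ge e$ ($\infty$ if there are none), and $e=\mathcal E_1(\pi_1^*)$, then $$\mathcal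 V_1(\pi^*_1)=\mathcal V^*_1(e)<\mathcal V^*_2(e).$$ -/

import Mathlib

open MeasureTheory ProbabilityTheory
open scoped ENNReal Matrix

/-- The data `(A, b, F, Q, r, γ)` of a scalar-input linear quadratic regulator on `ℝᵈ`:
`x (t+1) = A x t + u t b + n t` with i.i.d. disturbances `n t` of law `F`, stage cost
`xᵀ Q x + r u²` and discount factor `γ`. -/
structure LQR (d : ℕ) where
  A : Matrix (Fin d) (Fin d) ℝ
  b : Fin d → ℝ
  F : Measure (Fin d → ℝ)
  probF : IsProbabilityMeasure F
  Q : Matrix (Fin d) (Fin d) ℝ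
  r : ℝ
  γ : ℝ

/-- The (state, control) pairs at the times `0, …, n`. -/
abbrev LQRHistory (d n : ℕ) : Type := (i : Finset.Iic n) → (Fin d → ℝ) × ℝ

/-- The (state, control) pair at the last time of a history. -/
def LQRHistory.last {d n : ℕ} (h : LQRHistory d n) : (Fin d → ℝ) × ℝ :=
  h ⟨n, Finset.mem_Iic.2 le_rfl⟩

/-- A nonanticipatory, possibly randomized and history-dependent control policy. `first` is the law
of `u 0` given `x 0`, and `next n` is the law of `u (n+1)` given `(x 0, u 0), …, (x n, u n)` and
`x (n+1)`. -/
structure ControlPolicy (d : ℕ) where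
  first : Kernel (Fin d → ℝ) ℝ
  markov_first : IsMarkovKernel first
  next : (n : ℕ) → Kernel (LQRHistory d n × (Fin d → ℝ)) ℝ
  markov_next : ∀ n, IsMarkovKernel (next n)

namespace LQR

variable {d : ℕ}

/-- The law of `x (n+1) = A x n + u n b + n n` given the history up to time `n`. -/
noncomputable def stateKernel (S : LQR d) (n : ℕ) : Kernel (LQRHistory d n) (Fin d → ℝ) :=
  ((Kernel.id : Kernel (LQRHistory d n) (LQRHistory d n)) ×ₖ Kernel.const _ S.F).map
    (fun p => S.A *ᵥ p.1.last.1 + p.1.last.2 • S.b + p.2)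

/-- The law of `(x (n+1), u (n+1))` given the history up to time `n`, under the policy `π`. -/
noncomputable def stepKernel (S : LQR d) (π : ControlPolicy d) (n : ℕ) :
    Kernel (LQRHistory d n) ((Fin d → ℝ) × ℝ) :=
  S.stateKernel n ⊗ₖ π.next n

theorem measurable_update (S : LQR d) (n : ℕ) :
    Measurable (fun p : LQRHistory d n × (Fin d → ℝ) =>
      S.A *ᵥ p.1.last.1 + p.1.last.2 • S.b + p.2) := by
  unfold LQRHistory.last Matrix.mulVec dotProduct
  fun_prop

instance (S : LQR d) (n : ℕ) : IsMarkovKernel (S.stateKernel n) := by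
  have := S.probF
  exact Kernel.IsMarkovKernel.map _ (S.measurable_update n)

instance (S : LQR d) (π : ControlPolicy d) (n : ℕ) : IsMarkovKernel (S.stepKernel π n) := by
  have := π.markov_next n
  unfold stepKernel
  infer_instance

/-- The law on the space of sample paths `t ↦ (x t, u t)` that the policy `π` induces from the
initial state `x₀`. -/
noncomputable def pathMeasure (S : LQR d) (π : ControlPolicy d) (x₀ : Fin d → ℝ) :
    Measure (ℕ → (Fin d → ℝ) × ℝ) :=
  ((π.first x₀).map (fun u => (fun _ => (x₀, u) : LQRHistory d 0))).bind
    (Kernel.traj (X := fun _ => (Fin d → ℝ) × ℝ) (S.stepKernel π) 0)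

/-- The total discounted cost `E ∑ γᵗ (xᵀ Q x + r u²)` of the policy `π`, in `[0, ∞]`. -/
noncomputable def cost (S : LQR d) (π : ControlPolicy d) (x₀ : Fin d → ℝ) : ℝ≥0∞ :=
  ∫⁻ ω, ∑' t, ENNReal.ofReal
    (S.γ ^ t * ((ω t).1 ⬝ᵥ (S.Q *ᵥ (ω t).1) + S.r * (ω t).2 ^ 2)) ∂(S.pathMeasure π x₀)

/-- The state-penalizing cost `E ∑ γᵗ xᵀ Q x` of the policy `π`, in `[0, ∞]`. -/
noncomputable def stateCost (S : LQR d) (π : ControlPolicy d) (x₀ : Fin d → ℝ) : ℝ≥0∞ :=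
  ∫⁻ ω, ∑' t, ENNReal.ofReal
    (S.γ ^ t * ((ω t).1 ⬝ᵥ (S.Q *ᵥ (ω t).1))) ∂(S.pathMeasure π x₀)

/-- The efficiency `- E ∑ γᵗ xᵀ Q x` of the policy `π`. -/
noncomputable def efficiency (S : LQR d) (π : ControlPolicy d) (x₀ : Fin d → ℝ) : EReal :=
  -(S.stateCost π x₀ : EReal)

/-- The volatility `E ∑ γᵗ u²` of the policy `π`, in `[0, ∞]`. -/
noncomputable def volatility (S : LQR d) (π : ControlPolicy d) (x₀ : Fin d → ℝ) : ℝ≥0∞ :=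
  ∫⁻ ω, ∑' t, ENNReal.ofReal (S.γ ^ t * (ω t).2 ^ 2) ∂(S.pathMeasure π x₀)

/-- Admissible policies: efficiency and volatility are both finite. -/
def IsAdmissible (S : LQR d) (π : ControlPolicy d) (x₀ : Fin d → ℝ) : Prop :=
  S.stateCost π x₀ ≠ ∞ ∧ S.volatility π x₀ ≠ ∞

/-- The optimal cost, the infimum of the cost over all nonanticipatory policies. -/
noncomputable def optimalCost (S : LQR d) (x₀ : Fin d → ℝ) : ℝ≥0∞ :=
  ⨅ π : ControlPolicy d, S.cost π x₀

/-- `π` attains the optimal cost from `x₀`. -/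
def IsOptimal (S : LQR d) (π : ControlPolicy d) (x₀ : Fin d → ℝ) : Prop :=
  S.cost π x₀ = S.optimalCost x₀

/-- The least volatility of an admissible policy whose efficiency is at least `e`
(`∞` if there is no such policy). -/
noncomputable def minVolatility (S : LQR d) (x₀ : Fin d → ℝ) (e : EReal) : ℝ≥0∞ :=
  ⨅ π ∈ {π : ControlPolicy d | S.IsAdmissible π x₀ ∧ e ≤ S.efficiency π x₀}, S.volatility π x₀

/-- The trajectory of the disturbance-free system under the control sequence `u`. -/
noncomputable def noiselessState (S : LQR d) (x₀ : Fin d → ℝ) (u : ℕ → ℝ) : ℕ → (Fin d → ℝ)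
  | 0 => x₀
  | t + 1 => S.A *ᵥ noiselessState S x₀ u t + u t • S.b

/-- The total discounted cost of the control sequence `u` in the disturbance-free system. -/
noncomputable def noiselessCost (S : LQR d) (x₀ : Fin d → ℝ) (u : ℕ → ℝ) : ℝ≥0∞ :=
  ∑' t, ENNReal.ofReal (S.γ ^ t *
    (S.noiselessState x₀ u t ⬝ᵥ (S.Q *ᵥ S.noiselessState x₀ u t) + S.r * u t ^ 2))

end LQR

/-- The pair `(A, b)` is controllable: `[b, A b, …, A^(d-1) b]` has full rank. -/
def IsControllablePair {d : ℕ} (A : Matrix (Fin d) (Fin d) ℝ) (b : Fin d → ℝ) : Prop :=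
  (Matrix.of (fun (i k : Fin d) => ((A ^ (k : ℕ)) *ᵥ b) i)).rank = d

/-- The pair `(A, C)` is observable: a state with `C x = C A x = ⋯ = C A^(d-1) x = 0` is zero. -/
def IsObservablePair {d m : ℕ} (A : Matrix (Fin d) (Fin d) ℝ) (C : Matrix (Fin m) (Fin d) ℝ) :
    Prop :=
  ∀ x : Fin d → ℝ, (∀ k : Fin d, C *ᵥ ((A ^ (k : ℕ)) *ᵥ x) = 0) → x = 0

/-- The law `F` has finite second moments, mean zero and covariance matrix `Ψ`. -/
structure IsCenteredWithCovariance {d : ℕ} (F : Measure (Fin d → ℝ))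
    (Ψ : Matrix (Fin d) (Fin d) ℝ) : Prop where
  memLp : ∀ i, MemLp (fun n : Fin d → ℝ => n i) 2 F
  mean : ∀ i, ∫ n, n i ∂F = 0
  covariance : ∀ i j, ∫ n, n i * n j ∂F = Ψ i j

/-- The gain matrix of the market with state (demand, supply, price, renewable supply). -/
def renewableGain (β σ φ₁ φ₂ σr σc : ℝ) : Matrix (Fin 4) (Fin 4) ℝ :=
  !![β, 0, -φ₁, 0;
     0, σ, φ₂, 1;
     0, 0, 1, 0;
     0, 0, σc, σr]

/-- The market with renewable supply as a regulator on `ℝ⁴`: the control acts on the price. -/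
def renewableMarket (β σ φ₁ φ₂ σr σc : ℝ) (Q : Matrix (Fin 4) (Fin 4) ℝ) (r γ : ℝ)
    (F : Measure (Fin 4 → ℝ)) [hF : IsProbabilityMeasure F] : LQR 4 where
  A := renewableGain β σ φ₁ φ₂ σr σc
  b := ![0, 0, 1, 0]
  F := F
  probF := hF
  Q := Q
  r := r
  γ := γ

/-! Value iteration from `0` increases to a matrix `K` solving the Riccati equation; controllability
keeps it bounded, because some control steers the noiseless system to `0` in finitely many steps.
Completing the square in the Bellman equation shows that every policy costs at least `xᵀ K x +
γ/(1-γ) tr(K Ψ)`, with equality exactly for the feedback `u = G x` almost surely (`le_processCost`,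
`processCost_eq`, `ae_eq_of_processCost_eq`). `K` and `G` do not depend on the disturbance law.

The volatility of that feedback is itself the cost of an uncontrolled regulator with dynamics `A + b
Gᵀ` and penalty `G Gᵀ`. Hence the same theory gives `xᵀ P x + γ/(1-γ) tr(P Ψ)` for it, with `P`
again independent of the law.

The two covariances differ only in the last diagonal entry. So the optimal costs differ by `γ/(1-γ)
K₃₃ (ψr₂ - ψr₁)` and the volatilities by the same expression with `P₃₃` (indices from `0`).
Observability gives `K₃₃ > 0`. Moreover `P₃₃ > 0` exactly when the optimal noiseless control from
the renewable shock is not zero, which by uniqueness means that `u ≡ 0` is not optimal there. This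
is (a).

For (b), a policy of the second system that is at least as efficient as `π₁` has total cost at least
the second optimal cost. The strict gap between the optimal costs must then be paid in volatility,
uniformly over such policies.

The estimates are proved for abstract processes satisfying a second-moment identity
(`IsControlled`), so that they apply at once to random paths, to noiseless trajectories and to the
closed loop. -/

/-- The quadratic form `xᵀ K x`. -/
noncomputable def quadForm {d : ℕ} (K : Matrix (Fin d) (Fin d) ℝ) (x : Fin d → ℝ) : ℝ :=
  x ⬝ᵥ (K *ᵥ x)

/-! ### Quadratic forms and monotone convergence of symmetric matrices. -/

section QuadForm

variable {d : ℕ}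

theorem quadForm_add {K : Matrix (Fin d) (Fin d) ℝ} (hK : Kᵀ = K) (x y : Fin d → ℝ) :
    quadForm K (x + y) = quadForm K x + 2 * (x ⬝ᵥ (K *ᵥ y)) + quadForm K y := by
  have h : y ⬝ᵥ (K *ᵥ x) = x ⬝ᵥ (K *ᵥ y) := by
    rw [Matrix.dotProduct_mulVec, ← Matrix.mulVec_transpose, hK, dotProduct_comm]
  simp only [quadForm, Matrix.mulVec_add, add_dotProduct, dotProduct_add, h]
  ring

theorem quadForm_smul (K : Matrix (Fin d) (Fin d) ℝ) (c : ℝ) (x : Fin d → ℝ) :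
    quadForm K (c • x) = c ^ 2 * quadForm K x := by
  simp only [quadForm, Matrix.mulVec_smul, smul_dotProduct, dotProduct_smul, smul_eq_mul]
  ring

theorem quadForm_nonneg {K : Matrix (Fin d) (Fin d) ℝ} (hK : K.PosSemidef) (x : Fin d → ℝ) :
    0 ≤ quadForm K x := by
  simpa [quadForm] using hK.dotProduct_mulVec_nonneg x

theorem posSemidef_of_quadForm_nonneg {K : Matrix (Fin d) (Fin d) ℝ} (hK : Kᵀ = K)
    (h : ∀ x, 0 ≤ quadForm K x) : K.PosSemidef :=
  Matrix.PosSemidef.of_dotProduct_mulVec_nonneg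
    (by rw [Matrix.IsHermitian, Matrix.conjTranspose_eq_transpose_of_trivial, hK])
    fun x => by simpa [quadForm] using h x

theorem Matrix.PosSemidef.transpose_eq {K : Matrix (Fin d) (Fin d) ℝ} (hK : K.PosSemidef) :
    Kᵀ = K := by
  simpa [Matrix.IsHermitian, Matrix.conjTranspose_eq_transpose_of_trivial] using hK.isHermitian

theorem continuous_quadForm (K : Matrix (Fin d) (Fin d) ℝ) : Continuous (quadForm K) := by
  unfold quadForm; fun_prop

theorem measurable_quadForm (K : Matrix (Fin d) (Fin d) ℝ) : Measurable (quadForm K) :=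
  (continuous_quadForm K).measurable

theorem quadForm_vecMulVec (G x : Fin d → ℝ) :
    quadForm (Matrix.vecMulVec G G) x = (G ⬝ᵥ x) ^ 2 := by
  simp [quadForm, Matrix.vecMulVec_mulVec, dotProduct_smul]
  rw [dotProduct_comm x G]; ring

/-- A bounded, increasing sequence of symmetric matrices converges. -/
theorem exists_tendsto_of_quadForm_monotone {K : ℕ → Matrix (Fin d) (Fin d) ℝ}
    (hsymm : ∀ n, (K n)ᵀ = K n) (hmono : ∀ x, Monotone fun n => quadForm (K n) x)
    (hbdd : ∀ x, BddAbove (Set.range fun n => quadForm (K n) x)) :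
    ∃ L : Matrix (Fin d) (Fin d) ℝ, Filter.Tendsto K Filter.atTop (nhds L) := by
  have key : ∀ x, ∃ l, Filter.Tendsto (fun n => quadForm (K n) x) Filter.atTop (nhds l) :=
    fun x => ⟨_, tendsto_atTop_ciSup (hmono x) (hbdd x)⟩
  choose l hl using key
  -- Polarization recovers the matrix entries from limits of the forms.
  refine ⟨fun i j => (l (Pi.single i 1 + Pi.single j 1) - l (Pi.single i 1)
    - l (Pi.single j 1)) / 2, ?_⟩
  refine tendsto_pi_nhds.2 fun i => tendsto_pi_nhds.2 fun j => ?_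
  have := (((hl (Pi.single i 1 + Pi.single j 1)).sub (hl (Pi.single i 1))).sub
    (hl (Pi.single j 1))).div_const 2
  refine this.congr fun n => ?_
  rw [quadForm_add (hsymm n), Matrix.mulVec_single_one, single_one_dotProduct, Matrix.col_apply]
  ring

end QuadForm

/-! ### The Riccati operator and the limit of value iteration. -/

namespace LQR

variable {d : ℕ}

/-- The stage cost `xᵀ Q x + r u²`. -/
noncomputable def stageCost (S : LQR d) (x : Fin d → ℝ) (u : ℝ) : ℝ :=
  quadForm S.Q x + S.r * u ^ 2

/-- The next state `A x + u b` of the disturbance-free system. -/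
noncomputable def drift (S : LQR d) (x : Fin d → ℝ) (u : ℝ) : Fin d → ℝ :=
  S.A *ᵥ x + u • S.b

/-- The standing positivity conditions on the penalties and the discount factor. -/
structure IsRegular (S : LQR d) : Prop where
  posSemidef : S.Q.PosSemidef
  r_pos : 0 < S.r
  γ_pos : 0 < S.γ
  γ_lt_one : S.γ < 1

theorem IsRegular.stageCost_nonneg {S : LQR d} (hS : S.IsRegular) (x : Fin d → ℝ) (u : ℝ) :
    0 ≤ S.stageCost x u :=
  add_nonneg (quadForm_nonneg hS.posSemidef x) (mul_nonneg hS.r_pos.le (sq_nonneg u))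

theorem continuous_stageCost (S : LQR d) :
    Continuous fun p : (Fin d → ℝ) × ℝ => S.stageCost p.1 p.2 :=
  ((continuous_quadForm S.Q).comp continuous_fst).add (by fun_prop)

theorem continuous_drift (S : LQR d) :
    Continuous fun p : (Fin d → ℝ) × ℝ => S.drift p.1 p.2 := by
  unfold drift; fun_prop

/-- The curvature `r + γ bᵀ K b` of the one-step problem with terminal cost `K`. -/
noncomputable def curvature (S : LQR d) (K : Matrix (Fin d) (Fin d) ℝ) : ℝ :=
  S.r + S.γ * quadForm K S.b

/-- The optimal feedback gain of the one-step problem with terminal cost `K`. -/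
noncomputable def feedbackGain (S : LQR d) (K : Matrix (Fin d) (Fin d) ℝ) : Fin d → ℝ :=
  -(S.γ / S.curvature K) • (S.b ᵥ* (K * S.A))

/-- The Riccati operator. -/
noncomputable def riccatiStep (S : LQR d) (K : Matrix (Fin d) (Fin d) ℝ) :
    Matrix (Fin d) (Fin d) ℝ :=
  S.Q + S.γ • (S.Aᵀ * K * S.A)
    - S.curvature K • Matrix.vecMulVec (S.feedbackGain K) (S.feedbackGain K)

theorem IsRegular.curvature_pos {S : LQR d} (hS : S.IsRegular)
    {K : Matrix (Fin d) (Fin d) ℝ} (hK : K.PosSemidef) : 0 < S.curvature K :=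
  add_pos_of_pos_of_nonneg hS.r_pos (mul_nonneg hS.γ_pos.le (quadForm_nonneg hK _))

theorem feedbackGain_dotProduct (S : LQR d) (K : Matrix (Fin d) (Fin d) ℝ) (x : Fin d → ℝ) :
    S.feedbackGain K ⬝ᵥ x = -(S.γ / S.curvature K) * (S.b ⬝ᵥ (K *ᵥ (S.A *ᵥ x))) := by
  rw [feedbackGain, smul_dotProduct, ← Matrix.dotProduct_mulVec, Matrix.mulVec_mulVec,
    smul_eq_mul]

/-- Completion of the square in `u`. The minimum over `u`, the minimizer and the excess of any other
control are all read off from this identity. -/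
theorem IsRegular.stageCost_add {S : LQR d} (hS : S.IsRegular)
    {K : Matrix (Fin d) (Fin d) ℝ} (hK : K.PosSemidef) (x : Fin d → ℝ) (u : ℝ) :
    S.stageCost x u + S.γ * quadForm K (S.drift x u)
      = quadForm (S.riccatiStep K) x + S.curvature K * (u - S.feedbackGain K ⬝ᵥ x) ^ 2 := by
  have hρ := (hS.curvature_pos hK).ne'
  have h1 : quadForm (S.riccatiStep K) x = quadForm S.Q x + S.γ * quadForm K (S.A *ᵥ x)
      - S.curvature K * (S.feedbackGain K ⬝ᵥ x) ^ 2 := by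
    rw [← quadForm_vecMulVec]
    simp only [quadForm, riccatiStep, Matrix.sub_mulVec, Matrix.add_mulVec, Matrix.smul_mulVec,
      dotProduct_sub, dotProduct_add, dotProduct_smul, smul_eq_mul, ← Matrix.mulVec_mulVec]
    rw [Matrix.dotProduct_mulVec x S.Aᵀ, Matrix.vecMul_transpose]
  have h2 : S.b ⬝ᵥ (K *ᵥ (S.A *ᵥ x)) = -(S.curvature K / S.γ) * (S.feedbackGain K ⬝ᵥ x) := by
    rw [feedbackGain_dotProduct]
    have := hS.γ_pos.ne'
    field_simp
  rw [h1, stageCost, drift, add_comm (S.A *ᵥ x), quadForm_add hK.transpose_eq, smul_dotProduct,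
    h2, quadForm_smul, smul_eq_mul]
  have := hS.γ_pos.ne'
  have h3 : S.γ * quadForm K S.b = S.curvature K - S.r := by rw [curvature]; ring
  field_simp
  linear_combination u ^ 2 * h3

theorem IsRegular.posSemidef_riccatiStep {S : LQR d} (hS : S.IsRegular)
    {K : Matrix (Fin d) (Fin d) ℝ} (hK : K.PosSemidef) : (S.riccatiStep K).PosSemidef := by
  refine posSemidef_of_quadForm_nonneg ?_ fun x => ?_
  · simp only [riccatiStep, Matrix.transpose_sub, Matrix.transpose_add, Matrix.transpose_smul,
      Matrix.transpose_mul, Matrix.transpose_transpose, Matrix.transpose_vecMulVec,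
      hK.transpose_eq, hS.posSemidef.transpose_eq, Matrix.mul_assoc]
  · have h := hS.stageCost_add hK x (S.feedbackGain K ⬝ᵥ x)
    rw [sub_self, zero_pow two_ne_zero, mul_zero, add_zero] at h
    rw [← h]
    exact add_nonneg (hS.stageCost_nonneg _ _)
      (mul_nonneg hS.γ_pos.le (quadForm_nonneg hK _))

theorem IsRegular.quadForm_riccatiStep_le {S : LQR d} (hS : S.IsRegular)
    {K : Matrix (Fin d) (Fin d) ℝ} (hK : K.PosSemidef) (x : Fin d → ℝ) (u : ℝ) :
    quadForm (S.riccatiStep K) x ≤ S.stageCost x u + S.γ * quadForm K (S.drift x u) := by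
  rw [hS.stageCost_add hK]
  exact le_add_of_nonneg_right (mul_nonneg (hS.curvature_pos hK).le (sq_nonneg _))

/-- Value iteration from `0`. -/
noncomputable def riccatiIter (S : LQR d) (n : ℕ) : Matrix (Fin d) (Fin d) ℝ :=
  S.riccatiStep^[n] 0

theorem riccatiIter_succ (S : LQR d) (n : ℕ) :
    S.riccatiIter (n + 1) = S.riccatiStep (S.riccatiIter n) :=
  Function.iterate_succ_apply' _ _ _

theorem IsRegular.posSemidef_riccatiIter {S : LQR d} (hS : S.IsRegular) (n : ℕ) :
    (S.riccatiIter n).PosSemidef := by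
  induction n with
  | zero => exact Matrix.PosSemidef.zero
  | succ n ih => rw [riccatiIter_succ]; exact hS.posSemidef_riccatiStep ih

theorem IsRegular.quadForm_riccatiIter_mono {S : LQR d} (hS : S.IsRegular) (x : Fin d → ℝ) :
    Monotone fun n => quadForm (S.riccatiIter n) x := by
  refine monotone_nat_of_le_succ fun n => ?_
  induction n generalizing x with
  | zero =>
    refine le_trans (le_of_eq ?_) (quadForm_nonneg (hS.posSemidef_riccatiIter 1) x)
    simp [riccatiIter, quadForm]
  | succ n ih =>
    -- The control that is optimal for the later iterate is merely feasible for the earlier one; the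
    -- induction hypothesis then compares the terminal costs at the same next state.
    have h := hS.stageCost_add (hS.posSemidef_riccatiIter (n + 1)) x
      (S.feedbackGain (S.riccatiIter (n + 1)) ⬝ᵥ x)
    rw [sub_self, zero_pow two_ne_zero, mul_zero, add_zero] at h
    rw [riccatiIter_succ S (n + 1), ← h, riccatiIter_succ S n]
    refine (hS.quadForm_riccatiStep_le (hS.posSemidef_riccatiIter n) x
      (S.feedbackGain (S.riccatiIter (n + 1)) ⬝ᵥ x)).trans ?_
    rw [← riccatiIter_succ S n]
    have := mul_le_mul_of_nonneg_left (ih (S.drift x (S.feedbackGain (S.riccatiIter (n + 1)) ⬝ᵥ x)))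
      hS.γ_pos.le
    exact add_le_add_right this _

/-- `K` is the minimal solution of the Riccati equation, the limit of value iteration. -/
structure IsRiccatiLimit (S : LQR d) (K : Matrix (Fin d) (Fin d) ℝ) : Prop where
  posSemidef : K.PosSemidef
  tendsto : ∀ x, Filter.Tendsto (fun n => quadForm (S.riccatiIter n) x) Filter.atTop
    (nhds (quadForm K x))
  bellman : ∀ x u, S.stageCost x u + S.γ * quadForm K (S.drift x u)
    = quadForm K x + S.curvature K * (u - S.feedbackGain K ⬝ᵥ x) ^ 2

theorem IsRegular.exists_isRiccatiLimit_of_bddAbove {S : LQR d} (hS : S.IsRegular)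
    (hbdd : ∀ x, BddAbove (Set.range fun n => quadForm (S.riccatiIter n) x)) :
    ∃ K, S.IsRiccatiLimit K := by
  obtain ⟨K, hK⟩ := exists_tendsto_of_quadForm_monotone
    (fun n => (hS.posSemidef_riccatiIter n).transpose_eq) hS.quadForm_riccatiIter_mono hbdd
  have hlim : ∀ x y, Filter.Tendsto (fun n => x ⬝ᵥ (S.riccatiIter n *ᵥ y)) Filter.atTop
      (nhds (x ⬝ᵥ (K *ᵥ y))) := fun x y => by
    have : Continuous fun L : Matrix (Fin d) (Fin d) ℝ => x ⬝ᵥ (L *ᵥ y) := by fun_prop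
    exact (this.tendsto K).comp hK
  have hq : ∀ x, Filter.Tendsto (fun n => quadForm (S.riccatiIter n) x) Filter.atTop
    (nhds (quadForm K x)) := fun x => hlim x x
  have hpsd : K.PosSemidef := by
    refine posSemidef_of_quadForm_nonneg ?_ fun x =>
      ge_of_tendsto' (hq x) fun n => quadForm_nonneg (hS.posSemidef_riccatiIter n) x
    have : Continuous fun L : Matrix (Fin d) (Fin d) ℝ => Lᵀ := by fun_prop
    refine tendsto_nhds_unique ((this.tendsto K).comp hK) (hK.congr fun n => ?_)
    exact (hS.posSemidef_riccatiIter n).transpose_eq.symm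
  refine ⟨K, hpsd, hq, fun x u => ?_⟩
  -- The limiting curvature is positive, so the gains converge and the completed square passes to
  -- the limit.
  have hρ : Filter.Tendsto (fun n => S.curvature (S.riccatiIter n)) Filter.atTop
      (nhds (S.curvature K)) := ((hq S.b).const_mul S.γ).const_add S.r
  have hG : Filter.Tendsto (fun n => S.feedbackGain (S.riccatiIter n) ⬝ᵥ x) Filter.atTop
      (nhds (S.feedbackGain K ⬝ᵥ x)) := by
    simp only [feedbackGain_dotProduct]
    exact ((tendsto_const_nhds.div hρ (hS.curvature_pos hpsd).ne').neg).mul (hlim _ _)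
  have hl := ((hq (S.drift x u)).const_mul S.γ).const_add (S.stageCost x u)
  have hr := ((hq x).comp (Filter.tendsto_add_atTop_nat 1)).add
    (hρ.mul ((hG.const_sub u).pow 2))
  refine tendsto_nhds_unique hl (hr.congr fun n => ?_)
  rw [hS.stageCost_add (hS.posSemidef_riccatiIter n) x u, ← riccatiIter_succ]
  rfl

end LQR

/-! ### Lower bound, attainment and uniqueness for controlled processes. -/

namespace LQR

variable {d : ℕ} {Ω : Type*} [MeasurableSpace Ω]

/-- State and control processes `X`, `U` that satisfy `E X(t+1)ᵀ K X(t+1) =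
E (A X(t) + U(t) b)ᵀ K (A X(t) + U(t) b) + tr (K Ψ)`, the second-moment form of the system equation
with centered disturbances of covariance `Ψ` that are independent of the past. -/
structure IsControlled (S : LQR d) (Ψ : Matrix (Fin d) (Fin d) ℝ) (μ : Measure Ω)
    (X : ℕ → Ω → Fin d → ℝ) (U : ℕ → Ω → ℝ) : Prop where
  measurable_state : ∀ t, Measurable (X t)
  measurable_control : ∀ t, Measurable (U t)
  step : ∀ K : Matrix (Fin d) (Fin d) ℝ, K.PosSemidef → ∀ t,
    ∫⁻ ω, ENNReal.ofReal (quadForm K (X (t + 1) ω)) ∂μ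
      = ∫⁻ ω, ENNReal.ofReal (quadForm K (S.drift (X t ω) (U t ω))) ∂μ
        + ENNReal.ofReal (K * Ψ).trace

/-- The expected discounted cost of a pair of processes. -/
noncomputable def processCost (S : LQR d) (μ : Measure Ω) (X : ℕ → Ω → Fin d → ℝ)
    (U : ℕ → Ω → ℝ) : ℝ≥0∞ :=
  ∑' t, ENNReal.ofReal S.γ ^ t * ∫⁻ ω, ENNReal.ofReal (S.stageCost (X t ω) (U t ω)) ∂μ

/-- The expected value of the quadratic form `K`. -/
noncomputable def meanQuadForm (K : Matrix (Fin d) (Fin d) ℝ) (μ : Measure Ω)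
    (X : Ω → Fin d → ℝ) : ℝ≥0∞ :=
  ∫⁻ ω, ENNReal.ofReal (quadForm K (X ω)) ∂μ

/-- The discounted sum `∑ γᵗ tr (K Ψ)` over `t ≥ 1`, the cost of the disturbances. -/
noncomputable def noiseCost (S : LQR d) (Ψ K : Matrix (Fin d) (Fin d) ℝ) : ℝ≥0∞ :=
  ENNReal.ofReal S.γ * (1 - ENNReal.ofReal S.γ)⁻¹ * ENNReal.ofReal (K * Ψ).trace

theorem measurable_ofReal_quadForm (K : Matrix (Fin d) (Fin d) ℝ) {f : Ω → Fin d → ℝ}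
    (hf : Measurable f) : Measurable fun ω => ENNReal.ofReal (quadForm K (f ω)) :=
  ((measurable_quadForm K).comp hf).ennreal_ofReal

variable {S : LQR d} {Ψ K : Matrix (Fin d) (Fin d) ℝ} {μ : Measure Ω}
  {X : ℕ → Ω → Fin d → ℝ} {U : ℕ → Ω → ℝ}

theorem IsRegular.ofReal_γ_lt_one (hS : S.IsRegular) : ENNReal.ofReal S.γ < 1 := by
  simpa using (ENNReal.ofReal_lt_ofReal_iff one_pos).2 hS.γ_lt_one

theorem noiseCost_eq_tsum (S : LQR d) (Ψ K : Matrix (Fin d) (Fin d) ℝ) :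
    S.noiseCost Ψ K
      = ∑' t : ℕ, ENNReal.ofReal S.γ ^ (t + 1) * ENNReal.ofReal (K * Ψ).trace := by
  simp_rw [pow_succ']
  rw [ENNReal.tsum_mul_right, ENNReal.tsum_mul_left, ENNReal.tsum_geometric, noiseCost]

/-- The recursion that matches `processCost_succ`, used when one stage is split off. -/
theorem noiseCost_eq (S : LQR d) (Ψ K : Matrix (Fin d) (Fin d) ℝ) :
    S.noiseCost Ψ K
      = ENNReal.ofReal S.γ * (ENNReal.ofReal (K * Ψ).trace + S.noiseCost Ψ K) := by
  conv_lhs => rw [noiseCost_eq_tsum, tsum_eq_zero_add' ENNReal.summable]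
  rw [mul_add, zero_add, pow_one, noiseCost_eq_tsum, ← ENNReal.tsum_mul_left]
  simp_rw [pow_succ' _ (_ + 1), mul_assoc]

theorem IsRegular.noiseCost_ne_top (hS : S.IsRegular) (Ψ K : Matrix (Fin d) (Fin d) ℝ) :
    S.noiseCost Ψ K ≠ ∞ :=
  ENNReal.mul_ne_top (ENNReal.mul_ne_top ENNReal.ofReal_ne_top
    (ENNReal.inv_ne_top.2 (tsub_pos_of_lt hS.ofReal_γ_lt_one).ne')) ENNReal.ofReal_ne_top

theorem IsControlled.tail (h : S.IsControlled Ψ μ X U) :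
    S.IsControlled Ψ μ (fun t => X (t + 1)) fun t => U (t + 1) :=
  ⟨fun _ => h.1 _, fun _ => h.2 _, fun K hK _ => h.3 K hK _⟩

theorem processCost_succ (S : LQR d) (μ : Measure Ω) (X : ℕ → Ω → Fin d → ℝ)
    (U : ℕ → Ω → ℝ) :
    S.processCost μ X U = ∫⁻ ω, ENNReal.ofReal (S.stageCost (X 0 ω) (U 0 ω)) ∂μ
      + ENNReal.ofReal S.γ * S.processCost μ (fun t => X (t + 1)) fun t => U (t + 1) := by
  rw [processCost, tsum_eq_zero_add' ENNReal.summable, processCost, ← ENNReal.tsum_mul_left]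
  simp_rw [pow_succ', mul_assoc, pow_zero, one_mul]

theorem IsControlled.measurable_stageCost (h : S.IsControlled Ψ μ X U) (t : ℕ) :
    Measurable fun ω => S.stageCost (X t ω) (U t ω) :=
  S.continuous_stageCost.measurable.comp ((h.measurable_state t).prodMk (h.measurable_control t))

theorem IsControlled.measurable_drift (h : S.IsControlled Ψ μ X U) (t : ℕ) :
    Measurable fun ω => S.drift (X t ω) (U t ω) :=
  S.continuous_drift.measurable.comp ((h.measurable_state t).prodMk (h.measurable_control t))

theorem lintegral_stageCost_add (hS : S.IsRegular) (hK : K.PosSemidef)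
    (h : S.IsControlled Ψ μ X U) (t : ℕ) :
    ∫⁻ ω, ENNReal.ofReal (S.stageCost (X t ω) (U t ω)
        + S.γ * quadForm K (S.drift (X t ω) (U t ω))) ∂μ +
      ENNReal.ofReal S.γ * ENNReal.ofReal (K * Ψ).trace
      = ∫⁻ ω, ENNReal.ofReal (S.stageCost (X t ω) (U t ω)) ∂μ
        + ENNReal.ofReal S.γ * meanQuadForm K μ (X (t + 1)) := by
  rw [meanQuadForm, h.step K hK, mul_add, ← lintegral_const_mul _
    (measurable_ofReal_quadForm K (h.measurable_drift t)), ← add_assoc,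
    ← lintegral_add_left (h.measurable_stageCost t).ennreal_ofReal]
  congr 1
  refine lintegral_congr fun ω => ?_
  rw [ENNReal.ofReal_add (hS.stageCost_nonneg _ _)
    (mul_nonneg hS.γ_pos.le (quadForm_nonneg hK _)), ENNReal.ofReal_mul hS.γ_pos.le]

/-- The `n`-th iterate is the optimal noiseless cost of `n` stages. Later stages and the noise
contribute nonnegative amounts, which are dropped. -/
theorem meanQuadForm_riccatiIter_le (hS : S.IsRegular) (n : ℕ) (h : S.IsControlled Ψ μ X U) :
    meanQuadForm (S.riccatiIter n) μ (X 0) ≤ S.processCost μ X U := by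
  induction n generalizing X U with
  | zero => simp [meanQuadForm, riccatiIter, quadForm]
  | succ n ih =>
    have hn := hS.posSemidef_riccatiIter n
    rw [processCost_succ]
    refine le_trans ?_ (add_le_add_right (mul_le_mul_right (ih h.tail) _) _)
    rw [zero_add, ← zero_add 1, ← lintegral_stageCost_add hS hn h]
    refine le_trans (lintegral_mono fun ω => ENNReal.ofReal_le_ofReal ?_) le_self_add
    rw [zero_add, riccatiIter_succ]
    exact hS.quadForm_riccatiStep_le hn _ _

theorem IsRiccatiLimit.meanQuadForm_le (hK : S.IsRiccatiLimit K) (hS : S.IsRegular)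
    (h : S.IsControlled Ψ μ X U) : meanQuadForm K μ (X 0) ≤ S.processCost μ X U := by
  have hlim : ∀ ω, Filter.liminf (fun n => ENNReal.ofReal (quadForm (S.riccatiIter n) (X 0 ω)))
      Filter.atTop = ENNReal.ofReal (quadForm K (X 0 ω)) := fun ω =>
    (ENNReal.tendsto_ofReal (hK.tendsto (X 0 ω))).liminf_eq
  simp_rw [meanQuadForm, ← hlim]
  -- Fatou's lemma; the bound by the process cost is uniform in `n`.
  refine (lintegral_liminf_le fun n =>
    measurable_ofReal_quadForm _ (h.measurable_state 0)).trans ?_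
  exact Filter.liminf_le_of_le (by isBoundedDefault) fun b hb => by
    obtain ⟨n, hn⟩ := hb.exists
    exact hn.trans (meanQuadForm_riccatiIter_le hS n h)

/-- The Bellman equation for the expected cost of one stage. -/
theorem IsRiccatiLimit.lintegral_stageCost_add (hK : S.IsRiccatiLimit K) (hS : S.IsRegular)
    (h : S.IsControlled Ψ μ X U) :
    ∫⁻ ω, ENNReal.ofReal (S.stageCost (X 0 ω) (U 0 ω)) ∂μ
        + ENNReal.ofReal S.γ * meanQuadForm K μ (X 1)
      = meanQuadForm K μ (X 0)
        + ∫⁻ ω, ENNReal.ofReal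
          (S.curvature K * (U 0 ω - S.feedbackGain K ⬝ᵥ X 0 ω) ^ 2) ∂μ
        + ENNReal.ofReal S.γ * ENNReal.ofReal (K * Ψ).trace := by
  rw [← zero_add 1, ← LQR.lintegral_stageCost_add hS hK.posSemidef h, meanQuadForm,
    ← lintegral_add_left (measurable_ofReal_quadForm K (h.measurable_state 0))]
  congr 1
  refine lintegral_congr fun ω => ?_
  rw [hK.bellman]
  exact ENNReal.ofReal_add (quadForm_nonneg hK.posSemidef _)
    (mul_nonneg (hS.curvature_pos hK.posSemidef).le (sq_nonneg _))

/-- The value function is a lower bound for the cost. -/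
theorem IsRiccatiLimit.le_processCost (hK : S.IsRiccatiLimit K) (hS : S.IsRegular)
    (h : S.IsControlled Ψ μ X U) :
    meanQuadForm K μ (X 0) + S.noiseCost Ψ K ≤ S.processCost μ X U := by
  -- Only the first `n` noise terms are counted, so that induction on `n` starts from the bound
  -- without noise; each step restores one trace term and discards the nonnegative square.
  rw [noiseCost_eq_tsum, ENNReal.tsum_eq_iSup_nat, ENNReal.add_iSup]
  refine iSup_le fun n => ?_
  induction n generalizing X U with
  | zero => simpa using hK.meanQuadForm_le hS h
  | succ n ih =>
    rw [processCost_succ]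
    refine le_trans ?_ (add_le_add_right (mul_le_mul_right (ih h.tail) _) _)
    rw [mul_add, ← add_assoc, zero_add, hK.lintegral_stageCost_add hS h, Finset.sum_range_succ',
      Finset.mul_sum, zero_add, pow_one]
    simp_rw [pow_succ' _ (_ + 1), mul_assoc]
    rw [add_comm (Finset.sum _ _), ← add_assoc]
    gcongr
    exact le_self_add

/-- The feedback control attains the lower bound. -/
theorem IsRiccatiLimit.processCost_eq (hK : S.IsRiccatiLimit K) (hS : S.IsRegular)
    (h : S.IsControlled Ψ μ X U) (hU : ∀ t, ∀ᵐ ω ∂μ, U t ω = S.feedbackGain K ⬝ᵥ X t ω) :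
    S.processCost μ X U = meanQuadForm K μ (X 0) + S.noiseCost Ψ K := by
  refine le_antisymm ?_ (hK.le_processCost hS h)
  -- For the upper bound the cost itself is truncated to `n` stages; no terminal term survives, so
  -- the induction starts from `0`.
  rw [processCost, ENNReal.tsum_eq_iSup_nat]
  refine iSup_le fun n => ?_
  induction n generalizing X U with
  | zero => simp
  | succ n ih =>
    rw [Finset.sum_range_succ', add_comm, pow_zero, one_mul]
    simp_rw [pow_succ', mul_assoc]
    rw [← Finset.mul_sum]
    refine (add_le_add_right (mul_le_mul_right (ih h.tail fun t => hU _) _) _).trans ?_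
    rw [mul_add, ← add_assoc, zero_add, hK.lintegral_stageCost_add hS h]
    have h0 : ∫⁻ ω, ENNReal.ofReal
          (S.curvature K * (U 0 ω - S.feedbackGain K ⬝ᵥ X 0 ω) ^ 2) ∂μ = 0 := by
      rw [lintegral_eq_zero_iff' ?_]
      · filter_upwards [hU 0] with ω hω
        simp [hω]
      · refine AEMeasurable.ennreal_ofReal (Measurable.aemeasurable ?_)
        have h1 := h.measurable_state 0
        have h2 := h.measurable_control 0
        unfold dotProduct
        fun_prop
    rw [h0, add_zero, add_assoc, ← mul_add, ← noiseCost_eq]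

/-- If the lower bound is attained, then the first control is the feedback control and the lower
bound is attained again from time `1` on. -/
theorem IsRiccatiLimit.of_processCost_eq (hK : S.IsRiccatiLimit K) (hS : S.IsRegular)
    (h : S.IsControlled Ψ μ X U) (hfin : meanQuadForm K μ (X 0) ≠ ∞)
    (hcost : S.processCost μ X U = meanQuadForm K μ (X 0) + S.noiseCost Ψ K) :
    (∀ᵐ ω ∂μ, U 0 ω = S.feedbackGain K ⬝ᵥ X 0 ω) ∧ meanQuadForm K μ (X 1) ≠ ∞ ∧
      S.processCost μ (fun t => X (t + 1)) (fun t => U (t + 1))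
        = meanQuadForm K μ (X 1) + S.noiseCost Ψ K := by
  have hγ : ENNReal.ofReal S.γ ≠ 0 := (ENNReal.ofReal_pos.2 hS.γ_pos).ne'
  have hfin' := ENNReal.add_ne_top.2 ⟨hfin, hS.noiseCost_ne_top Ψ K⟩
  have hsucc := processCost_succ S μ X U
  have hlow := hK.le_processCost hS h.tail
  have hb := hK.lintegral_stageCost_add hS h
  set D := ∫⁻ ω, ENNReal.ofReal (S.curvature K * (U 0 ω - S.feedbackGain K ⬝ᵥ X 0 ω) ^ 2) ∂μ
    with hD
  set C := S.processCost μ (fun t => X (t + 1)) fun t => U (t + 1)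
  set E := ∫⁻ ω, ENNReal.ofReal (S.stageCost (X 0 ω) (U 0 ω)) ∂μ
  have hE : E ≠ ∞ := ne_top_of_le_ne_top hfin' (by rw [← hcost, hsucc]; exact le_self_add)
  have hC : C ≠ ∞ := fun hC => hfin' (by rw [← hcost, hsucc, hC, ENNReal.mul_top hγ, add_top])
  have hq : meanQuadForm K μ (X 1) ≠ ∞ := ne_top_of_le_ne_top hC (le_self_add.trans hlow)
  -- Continuing optimally after time `0` costs the optimum plus the defect `D` of the first control.
  -- Attainment with finite value forces `D = 0` and an optimal tail.
  have key : E + ENNReal.ofReal S.γ * (meanQuadForm K μ (X 1) + S.noiseCost Ψ K)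
      = meanQuadForm K μ (X 0) + S.noiseCost Ψ K + D := by
    rw [mul_add, ← add_assoc, hb, add_assoc, ← mul_add, ← noiseCost_eq, add_right_comm]
  refine ⟨?_, hq, le_antisymm ?_ hlow⟩
  · have hle : meanQuadForm K μ (X 0) + S.noiseCost Ψ K + D
        ≤ meanQuadForm K μ (X 0) + S.noiseCost Ψ K + 0 := by
      rw [← key, add_zero, ← hcost, hsucc]
      gcongr
    have hD0 : D = 0 := le_antisymm ((ENNReal.add_le_add_iff_left hfin').1 hle) bot_le
    rw [hD, lintegral_eq_zero_iff' ?_] at hD0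
    · filter_upwards [hD0] with ω hω
      have h1 := ENNReal.ofReal_eq_zero.1 hω
      have h2 := hS.curvature_pos hK.posSemidef
      have h3 : (U 0 ω - S.feedbackGain K ⬝ᵥ X 0 ω) ^ 2 ≤ 0 := by
        by_contra! h4
        exact absurd h1 (mul_pos h2 h4).not_ge
      exact sub_eq_zero.1 (pow_eq_zero_iff two_ne_zero |>.1 (le_antisymm h3 (sq_nonneg _)))
    · refine AEMeasurable.ennreal_ofReal (Measurable.aemeasurable ?_)
      have h1 := h.measurable_state 0
      have h2 := h.measurable_control 0
      unfold dotProduct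
      fun_prop
  · have hle : E + ENNReal.ofReal S.γ * C
        ≤ E + ENNReal.ofReal S.γ * (meanQuadForm K μ (X 1) + S.noiseCost Ψ K) := by
      rw [← hsucc, hcost, key]
      exact le_self_add
    exact (ENNReal.mul_le_mul_iff_right hγ ENNReal.ofReal_ne_top).1
      ((ENNReal.add_le_add_iff_left hE).1 hle)

/-- Only the feedback control attains the lower bound. -/
theorem IsRiccatiLimit.ae_eq_of_processCost_eq (hK : S.IsRiccatiLimit K) (hS : S.IsRegular)
    (h : S.IsControlled Ψ μ X U) (hfin : meanQuadForm K μ (X 0) ≠ ∞)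
    (hcost : S.processCost μ X U = meanQuadForm K μ (X 0) + S.noiseCost Ψ K) (t : ℕ) :
    ∀ᵐ ω ∂μ, U t ω = S.feedbackGain K ⬝ᵥ X t ω := by
  obtain ⟨h0, h1, h2⟩ := hK.of_processCost_eq hS h hfin hcost
  induction t generalizing X U with
  | zero => exact h0
  | succ t ih =>
    obtain ⟨h0', h1', h2'⟩ := hK.of_processCost_eq hS h.tail h1 h2
    exact ih h.tail h1 h2 h0' h1' h2'

end LQR

/-! ### Noiseless trajectories, existence of the limit, and the closed loop. -/

namespace LQR

variable {d : ℕ} {Ω : Type*} [MeasurableSpace Ω]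

section Existence

variable {S : LQR d}

/-- One noiseless trajectory of finite cost from each state bounds value iteration there. -/
theorem IsRegular.exists_isRiccatiLimit (hS : S.IsRegular)
    (hfin : ∀ x, ∃ (X : ℕ → Unit → Fin d → ℝ) (U : ℕ → Unit → ℝ),
      S.IsControlled 0 (Measure.dirac ()) X U ∧ X 0 () = x ∧
        S.processCost (Measure.dirac ()) X U ≠ ∞) :
    ∃ K, S.IsRiccatiLimit K := by
  refine hS.exists_isRiccatiLimit_of_bddAbove fun x => ?_
  obtain ⟨X, U, h, rfl, hcost⟩ := hfin x
  refine ⟨(S.processCost (Measure.dirac ()) X U).toReal, ?_⟩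
  rintro _ ⟨n, rfl⟩
  have := meanQuadForm_riccatiIter_le hS n h
  rw [meanQuadForm, lintegral_dirac] at this
  exact (ENNReal.ofReal_le_iff_le_toReal hcost).1 this

end Existence

section Noiseless

variable (S : LQR d) (x : Fin d → ℝ) (u : ℕ → ℝ)

theorem isControlled_noiseless : S.IsControlled 0 (Measure.dirac ())
    (fun t _ => S.noiselessState x u t) fun t _ => u t where
  measurable_state _ := measurable_const
  measurable_control _ := measurable_const
  step K _ t := by simp [noiselessState, drift]

variable {S} in
theorem IsRegular.processCost_noiseless (hS : S.IsRegular) :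
    S.processCost (Measure.dirac ()) (fun t _ => S.noiselessState x u t) (fun t _ => u t)
      = S.noiselessCost x u := by
  refine tsum_congr fun t => ?_
  rw [lintegral_dirac, ← ENNReal.ofReal_pow hS.γ_pos.le,
    ← ENNReal.ofReal_mul (pow_nonneg hS.γ_pos.le t)]
  rfl

theorem noiselessState_eq (t : ℕ) :
    S.noiselessState x u t
      = S.A ^ t *ᵥ x + ∑ j ∈ Finset.range t, u j • (S.A ^ (t - 1 - j) *ᵥ S.b) := by
  induction t with
  | zero => simp [noiselessState]
  | succ t ih =>
    rw [noiselessState, ih, Matrix.mulVec_add, Matrix.mulVec_mulVec, ← pow_succ',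
      Matrix.mulVec_sum, Finset.sum_range_succ, add_assoc]
    congr 2
    · refine Finset.sum_congr rfl fun j hj => ?_
      rw [Matrix.mulVec_smul, Matrix.mulVec_mulVec, ← pow_succ']
      congr 4
      have := Finset.mem_range.1 hj
      omega
    · simp

theorem exists_noiselessState_eq_zero (hctrl : IsControllablePair S.A S.b) :
    ∃ u, (∀ t, d ≤ t → u t = 0) ∧ S.noiselessState x u d = 0 := by
  set W : Matrix (Fin d) (Fin d) ℝ := Matrix.of fun i k => ((S.A ^ (k : ℕ)) *ᵥ S.b) i with hW
  have hsurj : Function.Surjective W.mulVecLin :=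
    LinearMap.range_eq_top.1
      (Submodule.eq_top_of_finrank_eq (by rw [Module.finrank_fin_fun]; exact hctrl))
  obtain ⟨w, hw⟩ := hsurj (-(S.A ^ d *ᵥ x))
  rw [Matrix.mulVecLin_apply] at hw
  -- At time `d` the control of time `t` has been carried to `A^(d-1-t) b`, hence the reversed order
  -- of the weights.
  refine ⟨fun t => if h : t < d then w ⟨d - 1 - t, by omega⟩ else 0, fun t ht => ?_, ?_⟩
  · simp [ht.not_gt]
  · rw [noiselessState_eq, add_eq_zero_iff_neg_eq, ← hw]
    rw [Finset.sum_range, Matrix.mulVec_eq_sum, ← Equiv.sum_comp Fin.revPerm]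
    refine Finset.sum_congr rfl fun j _ => ?_
    simp only [Fin.revPerm_apply, Fin.is_lt, dif_pos]
    have h1 : (⟨d - 1 - j, by omega⟩ : Fin d) = Fin.rev j := by
      ext; simp [Fin.rev]; omega
    have h2 : d - 1 - (j : ℕ) = (Fin.rev j : Fin d) := by simp [Fin.rev]; omega
    rw [h1, h2]
    ext i
    simp [hW, mul_comm]

theorem exists_noiselessCost_ne_top (hctrl : IsControllablePair S.A S.b) :
    ∃ u, S.noiselessCost x u ≠ ∞ := by
  obtain ⟨u, hu, h0⟩ := S.exists_noiselessState_eq_zero x hctrl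
  have hz : ∀ t, d ≤ t → S.noiselessState x u t = 0 := fun t ht => by
    induction t, ht using Nat.le_induction with
    | base => exact h0
    | succ t ht ih => simp [noiselessState, ih, hu t ht]
  refine ⟨u, ?_⟩
  rw [noiselessCost, tsum_eq_sum (s := Finset.range d) fun t ht => ?_]
  · exact ENNReal.sum_ne_top.2 fun _ _ => ENNReal.ofReal_ne_top
  · have ht : d ≤ t := by simpa using ht
    simp [hz t ht, hu t ht]

/-- The control and the state refer to each other; iterating the closed-loop map first breaks the
circle. -/
theorem exists_feedback_control (G : Fin d → ℝ) :
    ∃ u, ∀ t, u t = G ⬝ᵥ S.noiselessState x u t := by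
  let z : ℕ → Fin d → ℝ := fun t => (fun y => S.drift y (G ⬝ᵥ y))^[t] x
  have hz : ∀ t, S.noiselessState x (fun t => G ⬝ᵥ z t) t = z t := fun t => by
    induction t with
    | zero => rfl
    | succ t ih =>
      rw [noiselessState, ih]
      exact (Function.iterate_succ_apply' (fun y => S.drift y (G ⬝ᵥ y)) t x).symm
  exact ⟨_, fun t => by rw [hz]⟩

end Noiseless

section Volatility

/-- The expected discounted sum of the squared controls. -/
noncomputable def processVolatility (S : LQR d) (μ : Measure Ω) (U : ℕ → Ω → ℝ) : ℝ≥0∞ :=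
  ∑' t, ENNReal.ofReal S.γ ^ t * ∫⁻ ω, ENNReal.ofReal (U t ω ^ 2) ∂μ

/-- The regulator without control whose cost is the volatility of the feedback control `G`. -/
noncomputable def closedLoop (S : LQR d) (G : Fin d → ℝ) : LQR d where
  A := S.A + Matrix.vecMulVec S.b G
  b := 0
  F := S.F
  probF := S.probF
  Q := Matrix.vecMulVec G G
  -- Only the zero control is ever applied here, so any positive value serves.
  r := 1
  γ := S.γ

variable {S : LQR d} {Ψ K P : Matrix (Fin d) (Fin d) ℝ} {G : Fin d → ℝ} {μ : Measure Ω}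
  {X : ℕ → Ω → Fin d → ℝ} {U : ℕ → Ω → ℝ}

theorem IsRegular.closedLoop (hS : S.IsRegular) (G : Fin d → ℝ) : (S.closedLoop G).IsRegular where
  posSemidef := posSemidef_of_quadForm_nonneg (Matrix.transpose_vecMulVec _ _) fun x => by
    rw [LQR.closedLoop, quadForm_vecMulVec]; exact sq_nonneg _
  r_pos := one_pos
  γ_pos := hS.γ_pos
  γ_lt_one := hS.γ_lt_one

theorem closedLoop_drift (S : LQR d) (G x : Fin d → ℝ) :
    (S.closedLoop G).drift x 0 = S.drift x (G ⬝ᵥ x) := by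
  simp [drift, closedLoop, Matrix.add_mulVec, Matrix.vecMulVec_mulVec]

theorem closedLoop_feedbackGain (S : LQR d) (G : Fin d → ℝ) (P : Matrix (Fin d) (Fin d) ℝ) :
    (S.closedLoop G).feedbackGain P = 0 := by
  simp [feedbackGain, closedLoop]

theorem IsControlled.closedLoop (h : S.IsControlled Ψ μ X U)
    (hU : ∀ t, ∀ᵐ ω ∂μ, U t ω = G ⬝ᵥ X t ω) :
    (S.closedLoop G).IsControlled Ψ μ X fun _ _ => 0 where
  measurable_state := h.measurable_state
  measurable_control _ := measurable_const
  step K hK t := by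
    rw [h.step K hK]
    congr 1
    refine lintegral_congr_ae ?_
    filter_upwards [hU t] with ω hω
    rw [closedLoop_drift, hω]

theorem processCost_closedLoop (hU : ∀ t, ∀ᵐ ω ∂μ, U t ω = G ⬝ᵥ X t ω) :
    (S.closedLoop G).processCost μ X (fun _ _ => 0) = S.processVolatility μ U := by
  refine tsum_congr fun t => congrArg _ (lintegral_congr_ae ?_)
  filter_upwards [hU t] with ω hω
  simp [stageCost, closedLoop, quadForm_vecMulVec, hω]

theorem IsRegular.processVolatility_le (hS : S.IsRegular) :
    ENNReal.ofReal S.r * S.processVolatility μ U ≤ S.processCost μ X U := by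
  rw [processVolatility, ← ENNReal.tsum_mul_left]
  refine ENNReal.tsum_le_tsum fun t => ?_
  rw [mul_left_comm]
  gcongr
  rw [← lintegral_const_mul' _ _ ENNReal.ofReal_ne_top]
  refine lintegral_mono fun ω => ?_
  rw [← ENNReal.ofReal_mul hS.r_pos.le]
  exact ENNReal.ofReal_le_ofReal (le_add_of_nonneg_left (quadForm_nonneg hS.posSemidef _))

/-- The volatility of the optimal feedback control. -/
theorem IsRiccatiLimit.processVolatility_eq (hS : S.IsRegular)
    (hP : (S.closedLoop G).IsRiccatiLimit P) (h : S.IsControlled Ψ μ X U)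
    (hU : ∀ t, ∀ᵐ ω ∂μ, U t ω = G ⬝ᵥ X t ω) :
    S.processVolatility μ U = meanQuadForm P μ (X 0) + S.noiseCost Ψ P := by
  rw [← processCost_closedLoop hU]
  exact hP.processCost_eq (hS.closedLoop G) (h.closedLoop hU) (by simp [closedLoop_feedbackGain])

theorem noiseCost_zero (S : LQR d) (K : Matrix (Fin d) (Fin d) ℝ) : S.noiseCost 0 K = 0 := by
  simp [noiseCost]

theorem IsRiccatiLimit.exists_noiselessCost_eq (hK : S.IsRiccatiLimit K) (hS : S.IsRegular)
    (x : Fin d → ℝ) : ∃ u, (∀ t, u t = S.feedbackGain K ⬝ᵥ S.noiselessState x u t) ∧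
      S.noiselessCost x u = ENNReal.ofReal (quadForm K x) := by
  obtain ⟨u, hu⟩ := S.exists_feedback_control x (S.feedbackGain K)
  refine ⟨u, hu, ?_⟩
  rw [← hS.processCost_noiseless, hK.processCost_eq hS (S.isControlled_noiseless x u)
    fun t => Filter.Eventually.of_forall fun _ => hu t, noiseCost_zero, add_zero, meanQuadForm,
    lintegral_dirac]
  rfl

/-- The finite optimal noiseless cost dominates `r` times the volatility, so value iteration for the
closed loop is bounded too. -/
theorem IsRiccatiLimit.exists_closedLoop (hK : S.IsRiccatiLimit K) (hS : S.IsRegular) :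
    ∃ P, (S.closedLoop (S.feedbackGain K)).IsRiccatiLimit P := by
  refine (hS.closedLoop _).exists_isRiccatiLimit fun x => ?_
  obtain ⟨u, hu, hcost⟩ := hK.exists_noiselessCost_eq hS x
  have hu' : ∀ t, ∀ᵐ ω ∂(Measure.dirac ()),
      (fun (t : ℕ) (_ : Unit) => u t) t ω
        = S.feedbackGain K ⬝ᵥ (fun (t : ℕ) (_ : Unit) => S.noiselessState x u t) t ω :=
    fun t => Filter.Eventually.of_forall fun _ => hu t
  refine ⟨_, _, (S.isControlled_noiseless x u).closedLoop hu', rfl, ?_⟩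
  rw [processCost_closedLoop hu']
  have h1 := hS.processVolatility_le (μ := Measure.dirac ())
    (X := fun (t : ℕ) (_ : Unit) => S.noiselessState x u t) (U := fun (t : ℕ) (_ : Unit) => u t)
  rw [hS.processCost_noiseless, hcost] at h1
  intro h2
  rw [h2, ENNReal.mul_top (ENNReal.ofReal_pos.2 hS.r_pos).ne'] at h1
  exact ENNReal.ofReal_ne_top (top_le_iff.1 h1)

/-- Some control improves on the zero control exactly if the optimal feedback control has positive
volatility. -/
theorem IsRiccatiLimit.exists_noiselessCost_lt_iff (hK : S.IsRiccatiLimit K) (hS : S.IsRegular)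
    (hP : (S.closedLoop (S.feedbackGain K)).IsRiccatiLimit P) (x : Fin d → ℝ) :
    (∃ u : ℕ → ℝ, S.noiselessCost x u < S.noiselessCost x 0) ↔ 0 < quadForm P x := by
  have hvol : ∀ u : ℕ → ℝ, (∀ t, u t = S.feedbackGain K ⬝ᵥ S.noiselessState x u t) →
      S.processVolatility (Measure.dirac ()) (fun t _ => u t) = ENNReal.ofReal (quadForm P x) := by
    intro u hu
    rw [hP.processVolatility_eq hS (S.isControlled_noiseless x u)
      fun t => Filter.Eventually.of_forall fun _ => hu t, noiseCost_zero, add_zero, meanQuadForm,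
      lintegral_dirac]
    rfl
  have hlow : ∀ u : ℕ → ℝ, ENNReal.ofReal (quadForm K x) ≤ S.noiselessCost x u := fun u => by
    have := hK.le_processCost hS (S.isControlled_noiseless x u)
    rwa [noiseCost_zero, add_zero, meanQuadForm, lintegral_dirac, hS.processCost_noiseless] at this
  obtain ⟨v, hv, hcost⟩ := hK.exists_noiselessCost_eq hS x
  constructor
  · rintro ⟨u, hu⟩
    by_contra! hle
    have h0 : S.processVolatility (Measure.dirac ()) (fun t _ => v t) = 0 := by
      rw [hvol v hv, ENNReal.ofReal_eq_zero.2 hle]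
    -- Zero volatility makes the optimal control `v` vanish, so nothing improves on the zero
    -- control.
    have hv0 : v = 0 := funext fun t => by
      have := (ENNReal.tsum_eq_zero.1 h0 t)
      rw [lintegral_dirac] at this
      have h1 := (mul_eq_zero.1 this).resolve_left
        (pow_ne_zero _ (ENNReal.ofReal_pos.2 hS.γ_pos).ne')
      exact pow_eq_zero_iff two_ne_zero |>.1
        (le_antisymm (ENNReal.ofReal_eq_zero.1 h1) (sq_nonneg _))
    rw [hv0] at hcost
    exact absurd hu (by rw [hcost]; exact (hlow u).not_gt)
  · intro hpos
    -- If the zero control were optimal, uniqueness would make it the feedback control, whose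
    -- volatility is positive.
    refine ⟨v, hcost ▸ (hlow 0).lt_of_ne fun heq => ?_⟩
    have h0 := hvol 0 fun t => by
      have := hK.ae_eq_of_processCost_eq hS (S.isControlled_noiseless x 0)
        (by rw [meanQuadForm, lintegral_dirac]; exact ENNReal.ofReal_ne_top)
        (by rw [noiseCost_zero, add_zero, meanQuadForm, lintegral_dirac,
              hS.processCost_noiseless, ← heq]; rfl) t
      rw [ae_dirac_eq] at this
      exact this
    have : S.processVolatility (Measure.dirac ()) (fun t _ => (0 : ℕ → ℝ) t) = 0 := by
      simp [processVolatility]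
    rw [this] at h0
    exact (ENNReal.ofReal_pos.2 hpos).ne h0

/-- Zero optimal cost makes every stage cost vanish: `u = 0` since `r > 0`, so the state is `Aᵏ x`
with `C Aᵏ x = 0`, and observability gives `x = 0`. -/
theorem IsRiccatiLimit.quadForm_pos {m : ℕ} {C : Matrix (Fin m) (Fin d) ℝ}
    (hK : S.IsRiccatiLimit K) (hS : S.IsRegular) (hC : Cᵀ * C = S.Q)
    (hobs : IsObservablePair S.A C) {x : Fin d → ℝ} (hx : x ≠ 0) : 0 < quadForm K x := by
  by_contra! hle
  obtain ⟨u, -, hcost⟩ := hK.exists_noiselessCost_eq hS x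
  rw [ENNReal.ofReal_eq_zero.2 hle] at hcost
  have hstage : ∀ t, S.stageCost (S.noiselessState x u t) (u t) ≤ 0 := fun t => by
    have := ENNReal.ofReal_eq_zero.1 (ENNReal.tsum_eq_zero.1 hcost t)
    exact nonpos_of_mul_nonpos_right this (pow_pos hS.γ_pos t)
  have hu : ∀ t, u t = 0 := fun t => by
    have h1 := quadForm_nonneg hS.posSemidef (S.noiselessState x u t)
    have h2 := hstage t
    have h3 : S.r * u t ^ 2 ≤ 0 := by unfold stageCost at h2; linarith
    exact pow_eq_zero_iff two_ne_zero |>.1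
      (le_antisymm (nonpos_of_mul_nonpos_right h3 hS.r_pos) (sq_nonneg _))
  refine hx (hobs x fun k => ?_)
  have h1 := hstage k
  rw [noiselessState_eq] at h1
  simp only [hu, zero_smul, Finset.sum_const_zero, add_zero, stageCost, ne_eq, OfNat.ofNat_ne_zero,
    not_false_eq_true, zero_pow, mul_zero] at h1
  rw [← hC, quadForm, ← Matrix.mulVec_mulVec, Matrix.dotProduct_mulVec, Matrix.vecMul_transpose]
    at h1
  exact dotProduct_self_eq_zero.1 (le_antisymm h1 (Finset.sum_nonneg fun _ _ => mul_self_nonneg _))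

end Volatility

end LQR

/-! ### Second moments of the disturbances. -/

section Covariance

variable {d : ℕ} {F : Measure (Fin d → ℝ)} {Ψ : Matrix (Fin d) (Fin d) ℝ}

theorem quadForm_eq_sum (K : Matrix (Fin d) (Fin d) ℝ) (x : Fin d → ℝ) :
    quadForm K x = ∑ i, ∑ j, K i j * (x i * x j) := by
  simp only [quadForm, Matrix.mulVec, dotProduct, Finset.mul_sum]
  exact Finset.sum_congr rfl fun i _ => Finset.sum_congr rfl fun j _ => by ring

theorem IsCenteredWithCovariance.integrable_mul (hF : IsCenteredWithCovariance F Ψ) (i j : Fin d) :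
    Integrable (fun n : Fin d → ℝ => n i * n j) F :=
  (hF.memLp i).integrable_mul (hF.memLp j)

theorem IsCenteredWithCovariance.integrable_quadForm (hF : IsCenteredWithCovariance F Ψ)
    (K : Matrix (Fin d) (Fin d) ℝ) : Integrable (quadForm K) F := by
  rw [funext (quadForm_eq_sum K)]
  exact integrable_finsetSum _ fun i _ => integrable_finsetSum _ fun j _ =>
    (hF.integrable_mul i j).const_mul _

theorem IsCenteredWithCovariance.integral_quadForm (hF : IsCenteredWithCovariance F Ψ)
    (K : Matrix (Fin d) (Fin d) ℝ) : ∫ n, quadForm K n ∂F = (K * Ψ).trace := by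
  refine (integral_congr_ae (Filter.Eventually.of_forall (quadForm_eq_sum K))).trans ?_
  refine (integral_finsetSum _ fun i _ => integrable_finsetSum _ fun j _ =>
    (hF.integrable_mul i j).const_mul _).trans (Finset.sum_congr rfl fun i _ => ?_)
  refine (integral_finsetSum _ fun j _ => (hF.integrable_mul i j).const_mul _).trans ?_
  rw [Matrix.diag_apply, Matrix.mul_apply]
  refine Finset.sum_congr rfl fun j _ => ?_
  rw [integral_const_mul, ← hF.covariance j i]
  simp_rw [mul_comm]

theorem IsCenteredWithCovariance.trace_nonneg (hF : IsCenteredWithCovariance F Ψ)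
    {K : Matrix (Fin d) (Fin d) ℝ} (hK : K.PosSemidef) : 0 ≤ (K * Ψ).trace := by
  rw [← hF.integral_quadForm]
  exact integral_nonneg fun n => quadForm_nonneg hK n

theorem IsCenteredWithCovariance.lintegral_quadForm_add [IsProbabilityMeasure F]
    (hF : IsCenteredWithCovariance F Ψ) {K : Matrix (Fin d) (Fin d) ℝ} (hK : K.PosSemidef)
    (y : Fin d → ℝ) : ∫⁻ n, ENNReal.ofReal (quadForm K (y + n)) ∂F
      = ENNReal.ofReal (quadForm K y) + ENNReal.ofReal (K * Ψ).trace := by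
  have hlin : ∀ n : Fin d → ℝ, y ⬝ᵥ (K *ᵥ n) = ∑ i, (y ᵥ* K) i * n i := fun n =>
    Matrix.dotProduct_mulVec y K n
  have hi : ∀ i, Integrable (fun n : Fin d → ℝ => (y ᵥ* K) i * n i) F := fun i =>
    ((hF.memLp i).integrable one_le_two).const_mul _
  have h1 : Integrable (fun n => y ⬝ᵥ (K *ᵥ n)) F := by
    simp_rw [hlin]
    exact integrable_finsetSum _ fun i _ => hi i
  have h2 : ∫ n, y ⬝ᵥ (K *ᵥ n) ∂F = 0 := by
    simp_rw [hlin]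
    rw [integral_finsetSum _ fun i _ => hi i]
    exact Finset.sum_eq_zero fun i _ => by rw [integral_const_mul, hF.mean, mul_zero]
  have h3 : Integrable (fun n => quadForm K y + 2 * (y ⬝ᵥ (K *ᵥ n))) F :=
    (integrable_const _).add (h1.const_mul 2)
  have h4 : ∀ n, quadForm K (y + n) = quadForm K y + 2 * (y ⬝ᵥ (K *ᵥ n)) + quadForm K n :=
    quadForm_add hK.transpose_eq y
  rw [← ofReal_integral_eq_lintegral_ofReal, ← ENNReal.ofReal_add (quadForm_nonneg hK _)
    (hF.trace_nonneg hK)]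
  · simp_rw [h4]
    rw [integral_add h3 (hF.integrable_quadForm K), integral_add (integrable_const _)
      (h1.const_mul 2), integral_const_mul, h2, hF.integral_quadForm]
    simp
  · simp_rw [h4]
    exact h3.add (hF.integrable_quadForm K)
  · exact Filter.Eventually.of_forall fun n => quadForm_nonneg hK _

end Covariance

/-! ### One-step conditioning for trajectory kernels. -/

section Trajectory

variable {X : ℕ → Type*} [∀ n, MeasurableSpace (X n)]
  (κ : (n : ℕ) → Kernel ((i : Finset.Iic n) → X i) (X (n + 1))) [∀ n, IsMarkovKernel (κ n)]

theorem ProbabilityTheory.Kernel.lintegral_traj_frestrictLe_self (n : ℕ)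
    (h : (i : Finset.Iic n) → X i) {f : ((i : Finset.Iic n) → X i) → ℝ≥0∞} (hf : Measurable f) :
    ∫⁻ ω, f (Preorder.frestrictLe n ω) ∂(Kernel.traj κ n h) = f h := by
  rw [← MeasureTheory.lintegral_map hf (Preorder.measurable_frestrictLe n),
    Kernel.traj_map_frestrictLe_apply,
    Kernel.partialTraj_self, Kernel.id_apply, lintegral_dirac' _ hf]

theorem ProbabilityTheory.Kernel.lintegral_traj_succ {a n : ℕ} (han : a ≤ n)
    (h : (i : Finset.Iic a) → X i) {f : X (n + 1) → ℝ≥0∞} (hf : Measurable f) :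
    ∫⁻ ω, f (ω (n + 1)) ∂(Kernel.traj κ a h)
      = ∫⁻ ω, ∫⁻ p, f p ∂(κ n (Preorder.frestrictLe n ω)) ∂(Kernel.traj κ a h) := by
  have hκ : Measurable fun g => ∫⁻ p, f p ∂(κ n g) := hf.lintegral_kernel
  have hf' : Measurable fun ω : (n : ℕ) → X n => f (ω (n + 1)) :=
    hf.comp (measurable_pi_apply (n + 1))
  rw [← MeasureTheory.lintegral_map hκ (Preorder.measurable_frestrictLe n),
    Kernel.traj_map_frestrictLe_apply,
    -- The trajectory is restarted at time `n`, where its next coordinate has law `κ n`.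
    ← Kernel.traj_comp_partialTraj han, Kernel.lintegral_comp _ _ _ hf']
  refine lintegral_congr fun g => ?_
  rw [← Kernel.map_traj_succ_self (κ := κ) (a := n),
    Kernel.lintegral_map _ (measurable_pi_apply (n + 1)) _ hf]

end Trajectory

/-! ### Path measures of policies, optimal policies and minimal volatility. -/

namespace LQR

variable {d : ℕ} (S : LQR d) (π : ControlPolicy d) (x₀ : Fin d → ℝ)

theorem lintegral_stepKernel (n : ℕ) (h : LQRHistory d n) {f : (Fin d → ℝ) × ℝ → ℝ≥0∞}
    (hf : Measurable f) : ∫⁻ p, f p ∂(S.stepKernel π n h)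
      = ∫⁻ e, ∫⁻ u, f (S.drift h.last.1 h.last.2 + e, u)
        ∂(π.next n (h, S.drift h.last.1 h.last.2 + e)) ∂S.F := by
  have := S.probF
  have := π.markov_next n
  have hm : Measurable fun x : Fin d → ℝ => ∫⁻ u, f (x, u) ∂(π.next n (h, x)) :=
    (Measurable.lintegral_kernel_prod_right (κ := π.next n)
      (f := fun (p : LQRHistory d n × (Fin d → ℝ)) (u : ℝ) => f (p.2, u))
      (by fun_prop)).comp measurable_prodMk_left
  rw [stepKernel, Kernel.lintegral_compProd _ _ _ hf, stateKernel,
    Kernel.lintegral_map _ (S.measurable_update n) _ hm, Kernel.prod_apply, Kernel.id_apply,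
    Kernel.const_apply]
  have hm' := hm.comp (S.measurable_update n)
  refine (lintegral_prod _ hm'.aemeasurable).trans ?_
  rw [lintegral_dirac' _ hm'.lintegral_prod_right']
  rfl

theorem isProbabilityMeasure_initial :
    IsProbabilityMeasure ((π.first x₀).map fun u => (fun _ => (x₀, u) : LQRHistory d 0)) := by
  have := π.markov_first
  exact Measure.isProbabilityMeasure_map (by fun_prop)

theorem lintegral_pathMeasure {f : (ℕ → (Fin d → ℝ) × ℝ) → ℝ≥0∞} (hf : Measurable f) :
    ∫⁻ ω, f ω ∂(S.pathMeasure π x₀)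
      = ∫⁻ u, ∫⁻ ω, f ω ∂(Kernel.traj (X := fun _ => (Fin d → ℝ) × ℝ) (S.stepKernel π) 0
          (fun _ => (x₀, u))) ∂(π.first x₀) := by
  have hm : Measurable fun u : ℝ => (fun _ => (x₀, u) : LQRHistory d 0) :=
    measurable_pi_lambda _ fun _ => measurable_prodMk_left
  have hm' : Measurable fun h : LQRHistory d 0 => ∫⁻ ω, f ω
      ∂(Kernel.traj (X := fun _ => (Fin d → ℝ) × ℝ) (S.stepKernel π) 0 h) := hf.lintegral_kernel
  rw [pathMeasure, Measure.lintegral_bind (Kernel.measurable _).aemeasurable hf.aemeasurable]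
  exact lintegral_map hm' hm

theorem lintegral_pathMeasure_zero {f : (Fin d → ℝ) × ℝ → ℝ≥0∞} (hf : Measurable f) :
    ∫⁻ ω, f (ω 0) ∂(S.pathMeasure π x₀) = ∫⁻ u, f (x₀, u) ∂(π.first x₀) := by
  have h0 : Measurable fun h : LQRHistory d 0 => f h.last := hf.comp (measurable_pi_apply _)
  have h1 : Measurable fun ω : ℕ → (Fin d → ℝ) × ℝ => f (ω 0) := hf.comp (measurable_pi_apply _)
  rw [S.lintegral_pathMeasure π x₀ h1]
  exact lintegral_congr fun u => Kernel.lintegral_traj_frestrictLe_self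
    (X := fun _ => (Fin d → ℝ) × ℝ) (S.stepKernel π) 0 (fun _ => (x₀, u)) h0

theorem lintegral_pathMeasure_succ (n : ℕ) {f : (Fin d → ℝ) × ℝ → ℝ≥0∞} (hf : Measurable f) :
    ∫⁻ ω, f (ω (n + 1)) ∂(S.pathMeasure π x₀)
      = ∫⁻ ω, ∫⁻ e, ∫⁻ u, f (S.drift (ω n).1 (ω n).2 + e, u)
        ∂(π.next n (Preorder.frestrictLe n ω, S.drift (ω n).1 (ω n).2 + e)) ∂S.F
        ∂(S.pathMeasure π x₀) := by
  have hκ : Measurable fun h : LQRHistory d n => ∫⁻ p, f p ∂(S.stepKernel π n h) :=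
    hf.lintegral_kernel
  have h1 : Measurable fun ω : ℕ → (Fin d → ℝ) × ℝ => f (ω (n + 1)) :=
    hf.comp (measurable_pi_apply _)
  have h2 : Measurable fun ω : ℕ → (Fin d → ℝ) × ℝ =>
      ∫⁻ p, f p ∂(S.stepKernel π n (Preorder.frestrictLe n ω)) :=
    hκ.comp (Preorder.measurable_frestrictLe n)
  calc _ = ∫⁻ ω, ∫⁻ p, f p ∂(S.stepKernel π n (Preorder.frestrictLe n ω))
        ∂(S.pathMeasure π x₀) := by
        rw [S.lintegral_pathMeasure π x₀ h1, S.lintegral_pathMeasure π x₀ h2]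
        exact lintegral_congr fun u => Kernel.lintegral_traj_succ
          (X := fun _ => (Fin d → ℝ) × ℝ) (S.stepKernel π) (Nat.zero_le n) _ hf
    _ = _ := lintegral_congr fun ω => S.lintegral_stepKernel π n _ hf

/-- The bridge from arbitrary policies to the abstract estimates: the next control integrates out of
a function of the state alone, and the fresh centered disturbance adds exactly the trace. -/
theorem isControlled_pathMeasure {Ψ : Matrix (Fin d) (Fin d) ℝ}
    (hF : IsCenteredWithCovariance S.F Ψ) :
    S.IsControlled Ψ (S.pathMeasure π x₀) (fun t ω => (ω t).1) fun t ω => (ω t).2 where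
  measurable_state t := by fun_prop
  measurable_control t := by fun_prop
  step K hK t := by
    have := S.probF
    have := π.markov_first
    have hprob := isProbabilityMeasure_initial π x₀
    have : IsProbabilityMeasure (S.pathMeasure π x₀) := by
      unfold pathMeasure; infer_instance
    rw [S.lintegral_pathMeasure_succ π x₀ t
      (f := fun p => ENNReal.ofReal (quadForm K p.1))
      (measurable_ofReal_quadForm K measurable_fst)]
    have := π.markov_next t
    simp only [lintegral_const, measure_univ, mul_one, hF.lintegral_quadForm_add hK]
    rw [lintegral_add_right _ measurable_const, lintegral_const, measure_univ, mul_one]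

theorem meanQuadForm_pathMeasure (K : Matrix (Fin d) (Fin d) ℝ) :
    meanQuadForm K (S.pathMeasure π x₀) (fun ω => (ω 0).1) = ENNReal.ofReal (quadForm K x₀) := by
  have := π.markov_first
  rw [meanQuadForm, S.lintegral_pathMeasure_zero π x₀
    (f := fun p => ENNReal.ofReal (quadForm K p.1)) (measurable_ofReal_quadForm K measurable_fst)]
  simp

/-- The control policy `u = G x`. -/
noncomputable def _root_.ControlPolicy.feedback (G : Fin d → ℝ) : ControlPolicy d where
  first := Kernel.deterministic (fun x => G ⬝ᵥ x) (by unfold dotProduct; fun_prop)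
  markov_first := inferInstance
  next n := Kernel.deterministic (fun p => G ⬝ᵥ p.2) (by unfold dotProduct; fun_prop)
  markov_next n := inferInstance

theorem feedback_control_eq (G : Fin d → ℝ) (t : ℕ) :
    ∀ᵐ ω ∂(S.pathMeasure (ControlPolicy.feedback G) x₀), (ω t).2 = G ⬝ᵥ (ω t).1 := by
  -- The deviation from the feedback law has zero integral because the control kernels are Dirac.
  let f : (Fin d → ℝ) × ℝ → ℝ≥0∞ := fun p => ENNReal.ofReal (|p.2 - G ⬝ᵥ p.1|)
  have hf : Measurable f := by unfold f dotProduct; fun_prop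
  have h0 : ∀ x, f (x, G ⬝ᵥ x) = 0 := fun x => by simp [f]
  have key : ∫⁻ ω, f (ω t) ∂(S.pathMeasure (ControlPolicy.feedback G) x₀) = 0 := by
    cases t with
    | zero =>
      rw [S.lintegral_pathMeasure_zero _ x₀ hf, ControlPolicy.feedback,
        Kernel.deterministic_apply, lintegral_dirac' _ (by fun_prop), h0]
    | succ t =>
      rw [S.lintegral_pathMeasure_succ _ x₀ t hf]
      simp only [ControlPolicy.feedback, Kernel.deterministic_apply]
      have : ∀ x : Fin d → ℝ, ∫⁻ u, f (x, u) ∂(Measure.dirac (G ⬝ᵥ x)) = 0 := fun x => by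
        rw [lintegral_dirac' _ (by fun_prop), h0]
      simp only [this, lintegral_zero]
  rw [lintegral_eq_zero_iff (by fun_prop)] at key
  filter_upwards [key] with ω hω
  have h1 := ENNReal.ofReal_eq_zero.1 hω
  exact sub_eq_zero.1 (abs_nonpos_iff.1 h1)

variable {S}

theorem IsRegular.cost_eq (hS : S.IsRegular) : S.cost π x₀
    = S.processCost (S.pathMeasure π x₀) (fun t ω => (ω t).1) fun t ω => (ω t).2 := by
  have hm : ∀ t, Measurable fun ω : ℕ → (Fin d → ℝ) × ℝ =>
      ENNReal.ofReal (S.stageCost (ω t).1 (ω t).2) := fun t =>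
    (S.continuous_stageCost.measurable.comp (measurable_pi_apply t)).ennreal_ofReal
  have hp : ∀ (t : ℕ) (a : ℝ), ENNReal.ofReal (S.γ ^ t * a)
      = ENNReal.ofReal S.γ ^ t * ENNReal.ofReal a := fun t a => by
    rw [ENNReal.ofReal_mul (pow_nonneg hS.γ_pos.le t), ENNReal.ofReal_pow hS.γ_pos.le]
  unfold cost
  simp_rw [hp]
  refine (lintegral_tsum fun t => ((hm t).const_mul _).aemeasurable).trans ?_
  exact tsum_congr fun t => lintegral_const_mul _ (hm t)

theorem IsRegular.volatility_eq (hS : S.IsRegular) : S.volatility π x₀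
    = S.processVolatility (S.pathMeasure π x₀) fun t ω => (ω t).2 := by
  have hp : ∀ (t : ℕ) (a : ℝ), ENNReal.ofReal (S.γ ^ t * a)
      = ENNReal.ofReal S.γ ^ t * ENNReal.ofReal a := fun t a => by
    rw [ENNReal.ofReal_mul (pow_nonneg hS.γ_pos.le t), ENNReal.ofReal_pow hS.γ_pos.le]
  unfold volatility
  simp_rw [hp]
  have hm : ∀ t, Measurable fun ω : ℕ → (Fin d → ℝ) × ℝ => ENNReal.ofReal ((ω t).2 ^ 2) :=
    fun t => by fun_prop
  rw [lintegral_tsum fun t => ((hm t).const_mul _).aemeasurable]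
  exact tsum_congr fun t => lintegral_const_mul _ (hm t)

theorem IsRegular.cost_eq_stateCost_add (hS : S.IsRegular) :
    S.cost π x₀ = S.stateCost π x₀ + ENNReal.ofReal S.r * S.volatility π x₀ := by
  have hm : Measurable fun ω : ℕ → (Fin d → ℝ) × ℝ => ∑' t, ENNReal.ofReal
      (S.γ ^ t * ((ω t).1 ⬝ᵥ (S.Q *ᵥ (ω t).1))) := by
    refine Measurable.tsum fun t => ?_
    have := (measurable_quadForm S.Q).comp
      (measurable_fst.comp (measurable_pi_apply (X := fun _ : ℕ => (Fin d → ℝ) × ℝ) t))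
    exact (this.const_mul _).ennreal_ofReal
  rw [volatility, ← lintegral_const_mul' _ _ ENNReal.ofReal_ne_top, stateCost,
    ← lintegral_add_left hm, cost]
  refine lintegral_congr fun ω => ?_
  rw [← ENNReal.tsum_mul_left, ← ENNReal.tsum_add]
  refine tsum_congr fun t => ?_
  have hγ := pow_nonneg hS.γ_pos.le t
  have hq : 0 ≤ (ω t).1 ⬝ᵥ (S.Q *ᵥ (ω t).1) := quadForm_nonneg hS.posSemidef _
  rw [← ENNReal.ofReal_mul hS.r_pos.le, ← ENNReal.ofReal_add (mul_nonneg hγ hq)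
    (by have := hS.r_pos; positivity)]
  congr 1
  ring

variable {Ψ K P : Matrix (Fin d) (Fin d) ℝ}

theorem IsRiccatiLimit.le_cost (hK : S.IsRiccatiLimit K) (hS : S.IsRegular)
    (hF : IsCenteredWithCovariance S.F Ψ) :
    ENNReal.ofReal (quadForm K x₀) + S.noiseCost Ψ K ≤ S.cost π x₀ := by
  rw [hS.cost_eq, ← S.meanQuadForm_pathMeasure π x₀]
  exact hK.le_processCost hS (S.isControlled_pathMeasure π x₀ hF)

theorem IsRiccatiLimit.cost_feedback (hK : S.IsRiccatiLimit K) (hS : S.IsRegular)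
    (hF : IsCenteredWithCovariance S.F Ψ) :
    S.cost (ControlPolicy.feedback (S.feedbackGain K)) x₀
      = ENNReal.ofReal (quadForm K x₀) + S.noiseCost Ψ K := by
  rw [hS.cost_eq, hK.processCost_eq hS (S.isControlled_pathMeasure _ x₀ hF)
    (S.feedback_control_eq x₀ _), S.meanQuadForm_pathMeasure]

theorem IsRiccatiLimit.optimalCost_eq (hK : S.IsRiccatiLimit K) (hS : S.IsRegular)
    (hF : IsCenteredWithCovariance S.F Ψ) :
    S.optimalCost x₀ = ENNReal.ofReal (quadForm K x₀) + S.noiseCost Ψ K :=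
  le_antisymm ((iInf_le _ _).trans (hK.cost_feedback x₀ hS hF).le)
    (le_iInf fun π => hK.le_cost π x₀ hS hF)

theorem IsRiccatiLimit.isOptimal_feedback (hK : S.IsRiccatiLimit K) (hS : S.IsRegular)
    (hF : IsCenteredWithCovariance S.F Ψ) :
    S.IsOptimal (ControlPolicy.feedback (S.feedbackGain K)) x₀ :=
  (hK.cost_feedback x₀ hS hF).trans (hK.optimalCost_eq x₀ hS hF).symm

variable {π x₀}

theorem IsRiccatiLimit.cost_of_isOptimal (hK : S.IsRiccatiLimit K) (hS : S.IsRegular)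
    (hF : IsCenteredWithCovariance S.F Ψ) (hπ : S.IsOptimal π x₀) :
    S.cost π x₀ = ENNReal.ofReal (quadForm K x₀) + S.noiseCost Ψ K :=
  hπ.trans (hK.optimalCost_eq x₀ hS hF)

/-- By uniqueness every optimal policy, even a randomized one, follows the feedback law almost
surely, so all of them share one volatility. -/
theorem IsRiccatiLimit.volatility_of_isOptimal (hK : S.IsRiccatiLimit K) (hS : S.IsRegular)
    (hP : (S.closedLoop (S.feedbackGain K)).IsRiccatiLimit P)
    (hF : IsCenteredWithCovariance S.F Ψ) (hπ : S.IsOptimal π x₀) :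
    S.volatility π x₀ = ENNReal.ofReal (quadForm P x₀) + S.noiseCost Ψ P := by
  have h := S.isControlled_pathMeasure π x₀ hF
  have hcost := hK.cost_of_isOptimal hS hF hπ
  rw [hS.cost_eq, ← S.meanQuadForm_pathMeasure π x₀] at hcost
  rw [hS.volatility_eq, hP.processVolatility_eq hS h (hK.ae_eq_of_processCost_eq hS h
    (by rw [S.meanQuadForm_pathMeasure]; exact ENNReal.ofReal_ne_top) hcost),
    S.meanQuadForm_pathMeasure]

theorem IsRegular.isAdmissible_of_cost_ne_top (hS : S.IsRegular) (h : S.cost π x₀ ≠ ∞) :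
    S.IsAdmissible π x₀ := by
  rw [hS.cost_eq_stateCost_add, ENNReal.add_ne_top] at h
  refine ⟨h.1, fun h2 => h.2 ?_⟩
  rw [h2, ENNReal.mul_top (ENNReal.ofReal_pos.2 hS.r_pos).ne']

theorem IsRiccatiLimit.isAdmissible_of_isOptimal (hK : S.IsRiccatiLimit K) (hS : S.IsRegular)
    (hF : IsCenteredWithCovariance S.F Ψ) (hπ : S.IsOptimal π x₀) : S.IsAdmissible π x₀ := by
  refine hS.isAdmissible_of_cost_ne_top ?_
  rw [hK.cost_of_isOptimal hS hF hπ]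
  exact ENNReal.add_ne_top.2 ⟨ENNReal.ofReal_ne_top, hS.noiseCost_ne_top _ _⟩

theorem le_efficiency_iff {S' : LQR d} {π' : ControlPolicy d} :
    S.efficiency π x₀ ≤ S'.efficiency π' x₀ ↔ S'.stateCost π' x₀ ≤ S.stateCost π x₀ := by
  rw [efficiency, efficiency, EReal.neg_le_neg_iff, EReal.coe_ennreal_le_coe_ennreal_iff]

/-- An optimal policy has the least volatility at its efficiency. -/
theorem IsRegular.volatility_eq_minVolatility (hS : S.IsRegular) (hπ : S.IsOptimal π x₀)
    (hadm : S.IsAdmissible π x₀) :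
    S.volatility π x₀ = S.minVolatility x₀ (S.efficiency π x₀) := by
  refine le_antisymm (le_iInf₂ fun π' hπ' => ?_) (iInf₂_le π ⟨hadm, le_rfl⟩)
  have h1 : S.cost π x₀ ≤ S.cost π' x₀ := hπ.trans_le (iInf_le _ _)
  rw [hS.cost_eq_stateCost_add, hS.cost_eq_stateCost_add] at h1
  have h2 := h1.trans (add_le_add_left (le_efficiency_iff.1 hπ'.2) _)
  exact (ENNReal.mul_le_mul_iff_right (ENNReal.ofReal_pos.2 hS.r_pos).ne'
    ENNReal.ofReal_ne_top).1 ((ENNReal.add_le_add_iff_left hadm.1).1 h2)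

/-- If the optimal cost of a second system is larger, then more volatility is needed there for the
optimal efficiency of the first. -/
theorem IsRegular.volatility_lt_minVolatility (hS : S.IsRegular) {S' : LQR d}
    (hS' : S'.IsRegular) (hr : S'.r = S.r) (hπ : S.IsOptimal π x₀)
    (hlt : S.optimalCost x₀ < S'.optimalCost x₀) :
    S.volatility π x₀ < S'.minVolatility x₀ (S.efficiency π x₀) := by
  -- The infimum in the second system need not be attained; a level `c` strictly between the optimal
  -- costs gives one threshold for all competing policies.
  obtain ⟨c, hc, hc'⟩ := exists_between hlt
  have hr0 : ENNReal.ofReal S.r ≠ 0 := (ENNReal.ofReal_pos.2 hS.r_pos).ne'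
  refine lt_of_lt_of_le (b := (c - S.stateCost π x₀) / ENNReal.ofReal S.r) ?_
    (le_iInf₂ fun π' hπ' => ?_)
  · rw [ENNReal.lt_div_iff_mul_lt (Or.inl hr0) (Or.inl ENNReal.ofReal_ne_top), mul_comm]
    refine lt_tsub_iff_left.2 ?_
    rwa [← hS.cost_eq_stateCost_add, show S.cost π x₀ = _ from hπ]
  · refine ENNReal.div_le_of_le_mul ?_
    rw [tsub_le_iff_left, mul_comm, ← hr]
    refine hc'.le.trans ((iInf_le _ π').trans ?_)
    rw [hS'.cost_eq_stateCost_add]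
    exact add_le_add_left (le_efficiency_iff.1 hπ'.2) _

/-- The Riccati limit does not depend on the law of the disturbances. -/
theorem IsRiccatiLimit.of_eq {S' : LQR d} (hK : S.IsRiccatiLimit K) (hA : S.A = S'.A)
    (hb : S.b = S'.b) (hQ : S.Q = S'.Q) (hr : S.r = S'.r) (hγ : S.γ = S'.γ) :
    S'.IsRiccatiLimit K := by
  obtain ⟨A, b, F, pF, Q, r, γ⟩ := S
  obtain ⟨A', b', F', pF', Q', r', γ'⟩ := S'
  dsimp only at hA hb hQ hr hγ
  subst hA hb hQ hr hγ
  exact ⟨hK.1, hK.2, hK.3⟩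

end LQR

theorem ENNReal.lt_self_add_iff {a b : ℝ≥0∞} (ha : a ≠ ∞) : a < a + b ↔ 0 < b :=
  ⟨fun h => pos_iff_ne_zero.2 fun hb => by simp [hb] at h,
    fun h => ENNReal.lt_add_right ha h.ne'⟩

/-! ### Comparison of the two renewable sources. -/

namespace LQR

variable {d : ℕ} {S S' : LQR d}

theorem noiseCost_congr (hγ : S.γ = S'.γ) (Ψ K : Matrix (Fin d) (Fin d) ℝ) :
    S.noiseCost Ψ K = S'.noiseCost Ψ K := by
  rw [noiseCost, noiseCost, hγ]

/-- The additional cost of a larger disturbance of the last coordinate. -/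
theorem noiseCost_diagonal {ψd ψs ψr₁ ψr₂ : ℝ} {S : LQR 4} {K : Matrix (Fin 4) (Fin 4) ℝ}
    (hK : K.PosSemidef) (hψ : ψr₁ < ψr₂)
    (h₁ : 0 ≤ (K * Matrix.diagonal ![ψd, ψs, 0, ψr₁]).trace) :
    S.noiseCost (Matrix.diagonal ![ψd, ψs, 0, ψr₂]) K
      = S.noiseCost (Matrix.diagonal ![ψd, ψs, 0, ψr₁]) K
        + ENNReal.ofReal S.γ * (1 - ENNReal.ofReal S.γ)⁻¹
          * ENNReal.ofReal (quadForm K ![0, 0, 0, 1] * (ψr₂ - ψr₁)) := by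
  have hq : quadForm K ![0, 0, 0, 1] = K 3 3 := by
    simp [quadForm, Matrix.mulVec, dotProduct, Fin.sum_univ_four]
  have h : (K * Matrix.diagonal ![ψd, ψs, 0, ψr₂]).trace
      = (K * Matrix.diagonal ![ψd, ψs, 0, ψr₁]).trace
        + quadForm K ![0, 0, 0, 1] * (ψr₂ - ψr₁) := by
    simp [Matrix.trace, Fin.sum_univ_four, hq]
    ring
  rw [noiseCost, h, ENNReal.ofReal_add h₁
    (mul_nonneg (quadForm_nonneg hK _) (sub_pos.2 hψ).le), mul_add, ← noiseCost]

theorem IsRegular.discount_mul_pos_iff (hS : S.IsRegular) (a : ℝ) :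
    0 < ENNReal.ofReal S.γ * (1 - ENNReal.ofReal S.γ)⁻¹ * ENNReal.ofReal a ↔ 0 < a := by
  have h1 : ENNReal.ofReal S.γ ≠ 0 := (ENNReal.ofReal_pos.2 hS.γ_pos).ne'
  have h2 : (1 - ENNReal.ofReal S.γ)⁻¹ ≠ 0 :=
    ENNReal.inv_ne_zero.2 (ENNReal.sub_ne_top ENNReal.one_ne_top)
  rw [ENNReal.mul_pos_iff, ENNReal.ofReal_pos]
  exact and_iff_right (ENNReal.mul_pos h1 h2)

end LQR

theorem mainTheorem6
    (β σ φ₁ φ₂ σr σc : ℝ)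
    (hβ : 0 ≤ β) (hσ : 0 ≤ σ) (hφ₁ : 0 ≤ φ₁) (hφ₂ : 0 ≤ φ₂) (hσr : 0 < σr) (hσc : 0 < σc)
    (r γ : ℝ) (hr : 0 < r) (hγ₀ : 0 < γ) (hγ₁ : γ < 1)
    -- the state penalty `Q = Cᵀ C`, with the standing controllability and observability conditions
    (Q C : Matrix (Fin 4) (Fin 4) ℝ) (hC : Cᵀ * C = Q)
    (hctrl : IsControllablePair (renewableGain β σ φ₁ φ₂ σr σc) ![0, 0, 1, 0])
    (hobs : IsObservablePair (renewableGain β σ φ₁ φ₂ σr σc) C)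
    -- the disturbance laws for the two renewable sources
    (ψd ψs ψr₁ ψr₂ : ℝ)
    (F₁ F₂ : Measure (Fin 4 → ℝ)) [IsProbabilityMeasure F₁] [IsProbabilityMeasure F₂]
    (hF₁ : IsCenteredWithCovariance F₁ (Matrix.diagonal ![ψd, ψs, 0, ψr₁]))
    (hF₂ : IsCenteredWithCovariance F₂ (Matrix.diagonal ![ψd, ψs, 0, ψr₂]))
    (hψ : ψr₁ < ψr₂)
    (S₁ S₂ : LQR 4)
    (hS₁ : S₁ = renewableMarket β σ φ₁ φ₂ σr σc Q r γ F₁)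
    (hS₂ : S₂ = renewableMarket β σ φ₁ φ₂ σr σc Q r γ F₂)
    (z₀ : Fin 4 → ℝ) :
    -- optimal policies exist
    (∃ π, S₁.IsOptimal π z₀) ∧ (∃ π, S₂.IsOptimal π z₀) ∧
    ∀ π₁ π₂ : ControlPolicy 4, S₁.IsOptimal π₁ z₀ → S₂.IsOptimal π₂ z₀ →
      S₁.IsAdmissible π₁ z₀ ∧ S₂.IsAdmissible π₂ z₀ ∧
      -- the volatility under optimal pricing: strictly larger for the second source, except
      -- exactly when leaving the price alone is an optimal response to a renewable supply shock
      S₁.volatility π₁ z₀ ≤ S₂.volatility π₂ z₀ ∧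
      (S₁.volatility π₁ z₀ < S₂.volatility π₂ z₀ ↔
        ∃ u : ℕ → ℝ, S₁.noiselessCost ![0, 0, 0, 1] u < S₁.noiselessCost ![0, 0, 0, 1] 0) ∧
      -- the volatility needed to maintain the optimal efficiency: always strictly larger
      S₁.volatility π₁ z₀ = S₁.minVolatility z₀ (S₁.efficiency π₁ z₀) ∧
      S₁.minVolatility z₀ (S₁.efficiency π₁ z₀) < S₂.minVolatility z₀ (S₁.efficiency π₁ z₀) := by

  have hA₁ : S₁.A = renewableGain β σ φ₁ φ₂ σr σc := by rw [hS₁]; rfl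
  have hb₁ : S₁.b = ![0, 0, 1, 0] := by rw [hS₁]; rfl
  have hQ₁ : S₁.Q = Q := by rw [hS₁]; rfl
  have hA : S₁.A = S₂.A := by rw [hS₁, hS₂]; rfl
  have hb : S₁.b = S₂.b := by rw [hS₁, hS₂]; rfl
  have hQ : S₁.Q = S₂.Q := by rw [hS₁, hS₂]; rfl
  have hr' : S₁.r = S₂.r := by rw [hS₁, hS₂]; rfl
  have hγ : S₁.γ = S₂.γ := by rw [hS₁, hS₂]; rfl
  replace hF₁ : IsCenteredWithCovariance S₁.F (Matrix.diagonal ![ψd, ψs, 0, ψr₁]) := by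
    rw [hS₁]; exact hF₁
  replace hF₂ : IsCenteredWithCovariance S₂.F (Matrix.diagonal ![ψd, ψs, 0, ψr₂]) := by
    rw [hS₂]; exact hF₂
  have hQpsd : S₁.Q.PosSemidef := by
    rw [hQ₁, ← hC]
    simpa using Matrix.posSemidef_conjTranspose_mul_self C
  have hreg₁ : S₁.IsRegular := ⟨hQpsd, by rw [hS₁]; exact hr, by rw [hS₁]; exact hγ₀,
    by rw [hS₁]; exact hγ₁⟩
  have hreg₂ : S₂.IsRegular := ⟨hQ ▸ hQpsd, hr' ▸ hreg₁.r_pos, hγ ▸ hreg₁.γ_pos,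
    hγ ▸ hreg₁.γ_lt_one⟩
  obtain ⟨K, hK₁⟩ := hreg₁.exists_isRiccatiLimit fun x => by
    obtain ⟨u, hu⟩ := S₁.exists_noiselessCost_ne_top x (by rw [hA₁, hb₁]; exact hctrl)
    exact ⟨_, _, S₁.isControlled_noiseless x u, rfl, by rwa [hreg₁.processCost_noiseless]⟩
  have hK₂ : S₂.IsRiccatiLimit K := hK₁.of_eq hA hb hQ hr' hγ
  have hG : S₁.feedbackGain K = S₂.feedbackGain K := by
    simp only [LQR.feedbackGain, LQR.curvature, hA, hb, hr', hγ]
  obtain ⟨P, hP₁⟩ := hK₁.exists_closedLoop hreg₁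
  -- Equal gains give equal closed loops up to the law, so one `P` serves both systems.
  have hP₂ : (S₂.closedLoop (S₂.feedbackGain K)).IsRiccatiLimit P :=
    hP₁.of_eq (by simp only [LQR.closedLoop, hA, hb, hG]) rfl
      (by simp only [LQR.closedLoop, hG]) rfl hγ
  have hcostK := LQR.noiseCost_diagonal (S := S₁) hK₁.posSemidef hψ
    (hF₁.trace_nonneg hK₁.posSemidef)
  have hcostP := LQR.noiseCost_diagonal (S := S₁) hP₁.posSemidef hψ
    (hF₁.trace_nonneg hP₁.posSemidef)
  have hKpos : 0 < quadForm K ![0, 0, 0, 1] :=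
    hK₁.quadForm_pos hreg₁ (hC.trans hQ₁.symm) (hA₁ ▸ hobs) fun h => by
      simpa using congrFun h 3
  have hopt : S₁.optimalCost z₀ < S₂.optimalCost z₀ := by
    rw [hK₁.optimalCost_eq z₀ hreg₁ hF₁, hK₂.optimalCost_eq z₀ hreg₂ hF₂,
      ← LQR.noiseCost_congr hγ, hcostK, ← add_assoc]
    exact ENNReal.lt_add_right
      (ENNReal.add_ne_top.2 ⟨ENNReal.ofReal_ne_top, hreg₁.noiseCost_ne_top _ _⟩)
      ((hreg₁.discount_mul_pos_iff _).2 (mul_pos hKpos (sub_pos.2 hψ))).ne'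
  refine ⟨⟨_, hK₁.isOptimal_feedback z₀ hreg₁ hF₁⟩, ⟨_, hK₂.isOptimal_feedback z₀ hreg₂ hF₂⟩,
    fun π₁ π₂ hπ₁ hπ₂ => ?_⟩
  have hadm₁ := hK₁.isAdmissible_of_isOptimal hreg₁ hF₁ hπ₁
  have hmin := hreg₁.volatility_eq_minVolatility hπ₁ hadm₁
  have hvol₁ := hK₁.volatility_of_isOptimal hreg₁ hP₁ hF₁ hπ₁
  have hvol : S₂.volatility π₂ z₀ = S₁.volatility π₁ z₀
      + ENNReal.ofReal S₁.γ * (1 - ENNReal.ofReal S₁.γ)⁻¹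
        * ENNReal.ofReal (quadForm P ![0, 0, 0, 1] * (ψr₂ - ψr₁)) := by
    rw [hvol₁, hK₂.volatility_of_isOptimal hreg₂ hP₂ hF₂ hπ₂, ← LQR.noiseCost_congr hγ, hcostP,
      add_assoc]
  refine ⟨hadm₁, hK₂.isAdmissible_of_isOptimal hreg₂ hF₂ hπ₂,
    by rw [hvol]; exact le_self_add, ?_, hmin,
    hmin.symm.trans_lt (hreg₁.volatility_lt_minVolatility hreg₂ hr'.symm hπ₁ hopt)⟩
  -- Both sides reduce to positivity of `P` at the renewable shock.
  refine Iff.trans ?_ (hK₁.exists_noiselessCost_lt_iff hreg₁ hP₁ _).symm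
  rw [hvol, ENNReal.lt_self_add_iff hadm₁.2, hreg₁.discount_mul_pos_iff,
    mul_pos_iff_of_pos_right (sub_pos.2 hψ)]
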